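/- \textbf{Setting.} Let $d\in\mathbb N$ and let $\Omega_1,\dots,\Omega_d$ be finite sets. A ($d$-partite, weighted) complex $X$ is a probability distribution on $\Omega_1\times\cdots\times\Omega_d$; $X(d)$ denotes its support, and $x\sim X(d)$ a random tuple drawn from it. For $S\subseteq[d]$ write $x_S$ for the restriction of $x$ to the coordinates in $S$, and $X[S]$ for the set of all $x_S$ with $x\in X(d)$. For $z_S\in X[S]$ the link $X_{z_S}$ is the distribution of $x\sim X(d)$ conditioned on $x_S=z_S$, and $\mathbb E[f|_{z_S}]=\mathbb E[f(x)\mid x_S=z_S]$. $X$ is a \emph{$\gamma$-product} if for every $S\subseteq[d]$ with $|S|\le d-2$, every $z_S\in X[S]$ and all colors $i\ne j$ outside $S$, the operator $A_{i,j}g(v)=\mathbb E[g(x_i)\mid x_j=v]$ of the link $X_{z_S}$ satisfies $\lambda_2(A_{i,j})\le\gamma$, i.e. $\|A_{i,j}g-\mathbb E[g(x_i)]\|_2\le\gamma\|g\|_2$ for all $g:\Omega_i\to\mathbb R$, where expectations and norms are taken with respect to the link. The total influence of $f:X(d)\to\mathbb R$ is $\mathbf I[f]=\sum_{i=1}^d\mathbb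 E_{x\sim X(d)}\bigl[f(x)\bigl(f(x)-\mathbb E[f|_{x_{[d]\setminus\{i\}}}]\bigr)\bigr]$. \textbf{Theorem} (Booster theorem for HDX). There are absolute constants $c,C_1,C_2>0$ such that the following holds. Let $d\in\mathbb N$, let $X$ be a $d$-partite $\gamma$-product with $\gamma\le 2^{-cd}$, and let $f:X(d)\to\{\pm1\}$ satisfy $\mathbf I[f]\le K$ and $\mathrm{Var}(f)\ge .01$. Then there is some $\tau\ge 2^{-C_1K^2}$ such that \[ \Pr_{x\sim X(d)}\Bigl[\exists\, T\subseteq[d]:\ |T|\le C_2K\ \text{ and }\ \bigl|\mathbb E[f|_{x_T}]-\mathbb E[f]\bigr|\ge\tau\Bigr]\ \ge\ \tau . \] -/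

import Mathlib

universe u

noncomputable section

/-- A weighted `d`-partite complex on the finite vertex sets `Ω 0, …, Ω (d-1)`, presented as a
probability distribution on tuples with one vertex of each color. Its top-level faces `X(d)` are
the tuples of positive weight. -/
structure PartiteComplex {d : ℕ} (Ω : Fin d → Type u) [∀ i, Fintype (Ω i)] where
  weight : (∀ i, Ω i) → ℝ
  weight_nonneg : ∀ x, 0 ≤ weight x
  weight_sum : ∑ x, weight x = 1

namespace PartiteComplex

variable {d : ℕ} {Ω : Fin d → Type u} [∀ i, Fintype (Ω i)]

/-- `x_S = y_S`. -/
def AgreeOn (S : Finset (Fin d)) (x y : ∀ i, Ω i) : Prop := ∀ i ∈ S, x i = y i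

/-- `x ∈ X(d)`. -/
def IsFace (X : PartiteComplex Ω) (x : ∀ i, Ω i) : Prop := 0 < X.weight x

/-- `𝔼[f] = ∑ x, Π(x) f(x)`. -/
def expect (X : PartiteComplex Ω) (f : (∀ i, Ω i) → ℝ) : ℝ := ∑ x, X.weight x * f x

open Classical in
/-- The probability of an event under `x ∼ X(d)`. -/
def prob (X : PartiteComplex Ω) (p : (∀ i, Ω i) → Prop) : ℝ := ∑ x, if p x then X.weight x else 0

/-- `⟨f, g⟩ = 𝔼[f g]`. -/
def innerProd (X : PartiteComplex Ω) (f g : (∀ i, Ω i) → ℝ) : ℝ := X.expect fun x => f x * g x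

/-- `‖f‖₂ = 𝔼[f²]^{1/2}`. -/
def norm2 (X : PartiteComplex Ω) (f : (∀ i, Ω i) → ℝ) : ℝ := Real.sqrt (X.expect fun x => f x ^ 2)

/-- `Var(f) = 𝔼[(f - 𝔼 f)²]`. -/
def variance (X : PartiteComplex Ω) (f : (∀ i, Ω i) → ℝ) : ℝ :=
  X.expect fun x => (f x - X.expect f) ^ 2

open Classical in
/-- The averaging operator `E_S f (y) = 𝔼[f(x) | x_S = y_S]`, that is, `𝔼[f|_{y_S}]`. It is only
ever relevant at tuples `y` for which `x_S = y_S` has positive probability. -/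
def condExpect (X : PartiteComplex Ω) (S : Finset (Fin d)) (f : (∀ i, Ω i) → ℝ)
    (y : ∀ i, Ω i) : ℝ :=
  (∑ x, if AgreeOn S x y then X.weight x * f x else 0) / X.prob fun x => AgreeOn S x y

/-- The Laplacian `L_i f = f - E_{[d] ∖ {i}} f`. -/
def laplacian (X : PartiteComplex Ω) (i : Fin d) (f : (∀ i, Ω i) → ℝ) (x : ∀ i, Ω i) : ℝ :=
  f x - X.condExpect (Finset.univ.erase i) f x

/-- The total influence `I[f] = ∑ i, ⟨f, L_i f⟩`. -/
def totalInfluence (X : PartiteComplex Ω) (f : (∀ i, Ω i) → ℝ) : ℝ :=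
  ∑ i, X.innerProd f (X.laplacian i f)

theorem prob_agreeOn_pos (X : PartiteComplex Ω) (S : Finset (Fin d)) {z : ∀ i, Ω i}
    (hz : X.IsFace z) : 0 < X.prob fun x => AgreeOn S x z := by
  classical
  unfold prob
  refine Finset.sum_pos' (fun x _ => ?_) ⟨z, Finset.mem_univ _, ?_⟩
  · split_ifs
    exacts [X.weight_nonneg x, le_rfl]
  · have h : AgreeOn S z z := fun i _ => rfl
    simpa [h, IsFace] using hz

open Classical in
/-- The link of the sub-face `z_S` of a face `z`: the distribution of `x ∼ X(d)` conditioned on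
`x_S = z_S`. The (now constant) coordinates in `S` are kept in the tuple. -/
def link (X : PartiteComplex Ω) (S : Finset (Fin d)) (z : ∀ i, Ω i) (hz : X.IsFace z) :
    PartiteComplex Ω where
  weight x := (if AgreeOn S x z then X.weight x else 0) / X.prob fun x => AgreeOn S x z
  weight_nonneg x := by
    refine div_nonneg ?_ (X.prob_agreeOn_pos S hz).le
    split_ifs
    exacts [X.weight_nonneg x, le_rfl]
  weight_sum := by
    rw [← Finset.sum_div]
    exact div_self (X.prob_agreeOn_pos S hz).ne'

/-- The bipartite walk `A_{i,j} g (y_j) = 𝔼[g(x_i) | x_j = y_j]`, written as a function of the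
whole tuple `y`, of which it only uses the coordinate `y_j`. -/
def walk (X : PartiteComplex Ω) (i j : Fin d) (g : Ω i → ℝ) (y : ∀ i, Ω i) : ℝ :=
  X.condExpect {j} (fun x => g (x i)) y

/-- `‖A_{i,j} - Π_{i,j}‖₂ ≤ γ`, where `Π_{i,j} g` is the constant `𝔼[g(x_i)]`; equivalently, the
second largest singular value of `A_{i,j}` is at most `γ`. -/
def WalkExpands (X : PartiteComplex Ω) (i j : Fin d) (γ : ℝ) : Prop :=
  ∀ g : Ω i → ℝ,
    X.norm2 (fun y => X.walk i j g y - X.expect fun x => g (x i)) ≤ γ * X.norm2 fun x => g (x i)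

/-- `X` is a `γ`-product: in `X` and in all its links (of co-dimension at least `2`), all the
bipartite walks between two different remaining colors are `γ`-expanding. -/
def IsGammaProduct (X : PartiteComplex Ω) (γ : ℝ) : Prop :=
  ∀ (S : Finset (Fin d)) (z : ∀ i, Ω i) (hz : X.IsFace z) (i j : Fin d),
    i ∉ S → j ∉ S → i ≠ j → (X.link S z hz).WalkExpands i j γ

/-- `x_T` is a `τ`-booster of `f`. -/
def IsBooster (X : PartiteComplex Ω) (f : (∀ i, Ω i) → ℝ) (τ : ℝ) (T : Finset (Fin d))
    (x : ∀ i, Ω i) : Prop :=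
  τ ≤ |X.condExpect T f x - X.expect f|

end PartiteComplex

end

/-! The argument follows the Friedgut–Bourgain–Hatami scheme. Fix an order of the coordinates and
let `component S` be the ordered product of the Laplacians `L_i` for `i ∈ S` and the averages
`E_{[d] ∖ {i}}` for `i ∉ S`. These operators need not commute, but each `E_{[d] ∖ {i}}` is an
orthogonal projection, so Parseval holds exactly (`sum_expect_component_sq`). The expansion
hypothesis enters only through two approximations with error `2^{O(d)} γ`: `component S f` is close
to the alternating sum of the `E_T f` over `T ⊆ S`, and for `i ∈ S` it is close to `component S (L_i
f)`.

Hypercontractivity comes from randomization. The ordered product of the operators `E_{[d] ∖ {i}} ±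
L_i / 4` contracts `L⁴` and, dually, `L^{4/3}`. At a fixed `x` it is a polynomial in the signs with
coefficients `4^{-|S|} component S f x`, so the classical inequalities on the cube apply pointwise
and are then averaged over `x`.

Take `k` of order `K` and suppose that boosters of size at most `k` are rare. The variance is, up to
small errors, the weight of the components with `S` nonempty. The part with `|S| > k` is small by
the influence bound. At each `x`, a coordinate is notable if its damped low-degree influence there
is large. Sets containing a non-notable coordinate contribute little, by the `4/3`-norm bound
(`sum_expect_not_notable_le`). Points with a booster or with too many notable coordinates are rare,
and Cauchy–Schwarz with a fourth moment bound controls their contribution. At the other points few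
sets remain, and each of their components is small because no subset boosts. So
`variance_le_of_prob_booster_le` contradicts `Var(f) ≥ .01`. -/

set_option linter.unusedSectionVars false

noncomputable section

namespace PartiteComplex

variable {d : ℕ} {Ω : Fin d → Type u} [∀ i, Fintype (Ω i)]

/-! ### Expectations -/

theorem expect_congr (X : PartiteComplex Ω) {f g : (∀ i, Ω i) → ℝ}
    (h : ∀ x, X.IsFace x → f x = g x) : X.expect f = X.expect g := by
  refine Finset.sum_congr rfl fun x _ => ?_
  rcases (X.weight_nonneg x).eq_or_lt with h0 | h0
  · rw [← h0]; simp
  · rw [h x h0]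

theorem expect_mono (X : PartiteComplex Ω) {f g : (∀ i, Ω i) → ℝ}
    (h : ∀ x, X.IsFace x → f x ≤ g x) : X.expect f ≤ X.expect g := by
  refine Finset.sum_le_sum fun x _ => ?_
  rcases (X.weight_nonneg x).eq_or_lt with h0 | h0
  · rw [← h0]; simp
  · exact mul_le_mul_of_nonneg_left (h x h0) h0.le

theorem expect_const (X : PartiteComplex Ω) (c : ℝ) : X.expect (fun _ => c) = c := by
  rw [expect, ← Finset.sum_mul, X.weight_sum, one_mul]

theorem expect_nonneg (X : PartiteComplex Ω) {f : (∀ i, Ω i) → ℝ}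
    (h : ∀ x, X.IsFace x → 0 ≤ f x) : 0 ≤ X.expect f := by
  simpa [expect_const] using X.expect_mono (f := fun _ => 0) h

theorem expect_add (X : PartiteComplex Ω) (f g : (∀ i, Ω i) → ℝ) :
    X.expect (fun x => f x + g x) = X.expect f + X.expect g := by
  simp only [expect, mul_add, Finset.sum_add_distrib]

theorem expect_sub (X : PartiteComplex Ω) (f g : (∀ i, Ω i) → ℝ) :
    X.expect (fun x => f x - g x) = X.expect f - X.expect g := by
  simp only [expect, mul_sub, Finset.sum_sub_distrib]

theorem expect_const_mul (X : PartiteComplex Ω) (c : ℝ) (f : (∀ i, Ω i) → ℝ) :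
    X.expect (fun x => c * f x) = c * X.expect f := by
  simp only [expect, Finset.mul_sum]
  exact Finset.sum_congr rfl fun x _ => by ring

theorem expect_sum (X : PartiteComplex Ω) {ι : Type*} (s : Finset ι)
    (f : ι → (∀ i, Ω i) → ℝ) :
    X.expect (fun x => ∑ a ∈ s, f a x) = ∑ a ∈ s, X.expect (f a) := by
  simp only [expect, Finset.mul_sum]
  exact Finset.sum_comm

open Classical in
theorem prob_eq_expect (X : PartiteComplex Ω) (p : (∀ i, Ω i) → Prop) :
    X.prob p = X.expect fun x => if p x then 1 else 0 := by
  simp [prob, expect]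

/-- The Cauchy–Schwarz inequality. -/
theorem expect_mul_sq_le (X : PartiteComplex Ω) (f g : (∀ i, Ω i) → ℝ) :
    (X.expect fun x => f x * g x) ^ 2
      ≤ (X.expect fun x => f x ^ 2) * X.expect fun x => g x ^ 2 := by
  have h := Finset.sum_mul_sq_le_sq_mul_sq Finset.univ
    (fun x => Real.sqrt (X.weight x) * f x) (fun x => Real.sqrt (X.weight x) * g x)
  have hw : ∀ x, Real.sqrt (X.weight x) * Real.sqrt (X.weight x) = X.weight x :=
    fun x => Real.mul_self_sqrt (X.weight_nonneg x)
  have e : ∀ a b : (∀ i, Ω i) → ℝ,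
      ∑ x, (Real.sqrt (X.weight x) * a x) * (Real.sqrt (X.weight x) * b x)
        = X.expect fun x => a x * b x := fun a b =>
    Finset.sum_congr rfl fun x _ => by rw [mul_mul_mul_comm, hw]
  simpa only [pow_two, e] using h

/-! ### The `L²` seminorm -/

theorem norm2_nonneg (X : PartiteComplex Ω) (f : (∀ i, Ω i) → ℝ) : 0 ≤ X.norm2 f :=
  Real.sqrt_nonneg _

theorem norm2_sq (X : PartiteComplex Ω) (f : (∀ i, Ω i) → ℝ) :
    X.norm2 f ^ 2 = X.expect fun x => f x ^ 2 :=
  Real.sq_sqrt (X.expect_nonneg fun _ _ => sq_nonneg _)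

theorem norm2_congr (X : PartiteComplex Ω) {f g : (∀ i, Ω i) → ℝ}
    (h : ∀ x, X.IsFace x → f x = g x) : X.norm2 f = X.norm2 g := by
  unfold norm2
  rw [X.expect_congr fun x hx => by rw [h x hx]]

/-- Absorbing the square roots of the weights gives a Euclidean norm, which supplies the triangle
inequality and homogeneity. -/
theorem norm2_eq_norm (X : PartiteComplex Ω) (f : (∀ i, Ω i) → ℝ) :
    X.norm2 f = ‖WithLp.toLp 2 fun x => Real.sqrt (X.weight x) * f x‖ := by
  rw [EuclideanSpace.norm_eq, norm2, expect]
  congr 1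
  refine Finset.sum_congr rfl fun x _ => ?_
  rw [Real.norm_eq_abs, sq_abs, mul_pow, Real.sq_sqrt (X.weight_nonneg x)]

theorem norm2_add_le (X : PartiteComplex Ω) (f g : (∀ i, Ω i) → ℝ) :
    X.norm2 (f + g) ≤ X.norm2 f + X.norm2 g := by
  simp only [norm2_eq_norm]
  refine le_trans (le_of_eq ?_) (norm_add_le _ _)
  congr 1
  ext x
  simp [mul_add]

theorem norm2_smul (X : PartiteComplex Ω) (c : ℝ) (f : (∀ i, Ω i) → ℝ) :
    X.norm2 (c • f) = |c| * X.norm2 f := by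
  simp only [norm2_eq_norm]
  rw [← Real.norm_eq_abs, ← norm_smul]
  congr 1
  ext x
  simp only [Pi.smul_apply, smul_eq_mul, PiLp.smul_apply]
  ring

theorem norm2_zero (X : PartiteComplex Ω) : X.norm2 0 = 0 := by
  simpa using X.norm2_smul 0 0

theorem norm2_sum_le (X : PartiteComplex Ω) {ι : Type*} (s : Finset ι)
    (f : ι → (∀ i, Ω i) → ℝ) : X.norm2 (∑ a ∈ s, f a) ≤ ∑ a ∈ s, X.norm2 (f a) := by
  classical
  induction s using Finset.induction_on with
  | empty => simp [norm2_zero]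
  | insert a s ha ih =>
    rw [Finset.sum_insert ha, Finset.sum_insert ha]
    exact (X.norm2_add_le _ _).trans (by gcongr)

theorem norm2_le_of_sq_le (X : PartiteComplex Ω) {f : (∀ i, Ω i) → ℝ} {c : ℝ} (hc : 0 ≤ c)
    (h : (X.expect fun x => f x ^ 2) ≤ c ^ 2) : X.norm2 f ≤ c :=
  (Real.sqrt_le_sqrt h).trans_eq (Real.sqrt_sq hc)

theorem expect_sq_le_of_norm2_le (X : PartiteComplex Ω) {f : (∀ i, Ω i) → ℝ} {c : ℝ}
    (h : X.norm2 f ≤ c) : (X.expect fun x => f x ^ 2) ≤ c ^ 2 := by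
  rw [← norm2_sq]
  exact pow_le_pow_left₀ (X.norm2_nonneg f) h 2

/-! ### Conditional expectations -/

theorem AgreeOn.symm {S : Finset (Fin d)} {x y : ∀ i, Ω i} (h : AgreeOn S x y) :
    AgreeOn S y x := fun i hi => (h i hi).symm

theorem AgreeOn.trans {S : Finset (Fin d)} {x y z : ∀ i, Ω i} (h : AgreeOn S x y)
    (h' : AgreeOn S y z) : AgreeOn S x z := fun i hi => (h i hi).trans (h' i hi)

theorem AgreeOn.mono {S T : Finset (Fin d)} (hST : S ⊆ T) {x y : ∀ i, Ω i}
    (h : AgreeOn T x y) : AgreeOn S x y := fun i hi => h i (hST hi)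

/-- `f` only depends on the coordinates in `S`. -/
def DependsOnly (S : Finset (Fin d)) (f : (∀ i, Ω i) → ℝ) : Prop :=
  ∀ x y, AgreeOn S x y → f x = f y

theorem DependsOnly.mono {S T : Finset (Fin d)} (hST : S ⊆ T) {f : (∀ i, Ω i) → ℝ}
    (h : DependsOnly S f) : DependsOnly T f := fun x y hxy => h x y (hxy.mono hST)

open Classical in
/-- The indicator of `x_S = y_S`. -/
def cylinder (S : Finset (Fin d)) (y x : ∀ i, Ω i) : ℝ := if AgreeOn S x y then 1 else 0

theorem dependsOnly_cylinder (S : Finset (Fin d)) (y : ∀ i, Ω i) :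
    DependsOnly S (cylinder S y) := by
  intro x x' h
  classical
  have : AgreeOn S x y ↔ AgreeOn S x' y := ⟨fun h' => h.symm.trans h', fun h' => h.trans h'⟩
  exact if_congr this rfl rfl

theorem cylinder_comm (S : Finset (Fin d)) (x y : ∀ i, Ω i) :
    cylinder S x y = cylinder S y x := by
  classical
  have : AgreeOn S y x ↔ AgreeOn S x y := ⟨AgreeOn.symm, AgreeOn.symm⟩
  exact if_congr this rfl rfl

theorem cylinder_congr {S : Finset (Fin d)} {y y' : ∀ i, Ω i} (h : AgreeOn S y y') :
    cylinder S y = cylinder S y' := by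
  funext x
  rw [cylinder_comm, cylinder_comm S y']
  exact dependsOnly_cylinder S x y y' h

theorem condExpect_eq_div (X : PartiteComplex Ω) (S : Finset (Fin d)) (f : (∀ i, Ω i) → ℝ)
    (y : ∀ i, Ω i) : X.condExpect S f y
      = (X.expect fun x => cylinder S y x * f x) / X.expect (cylinder S y) := by
  rw [condExpect, prob_eq_expect]
  congr 1
  refine Finset.sum_congr rfl fun x _ => ?_
  change _ = X.weight x * (cylinder S y x * f x)
  unfold cylinder
  split_ifs <;> simp

theorem expect_cylinder_pos (X : PartiteComplex Ω) (S : Finset (Fin d)) {y : ∀ i, Ω i}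
    (hy : X.IsFace y) : 0 < X.expect (cylinder S y) := by
  have h := X.prob_agreeOn_pos S hy
  rwa [prob_eq_expect] at h

theorem dependsOnly_condExpect (X : PartiteComplex Ω) (S : Finset (Fin d))
    (f : (∀ i, Ω i) → ℝ) : DependsOnly S (X.condExpect S f) := by
  intro x y h
  rw [condExpect_eq_div, condExpect_eq_div, cylinder_congr h]

theorem condExpect_mul_left (X : PartiteComplex Ω) {S : Finset (Fin d)} {h : (∀ i, Ω i) → ℝ}
    (hh : DependsOnly S h) (f : (∀ i, Ω i) → ℝ) (y : ∀ i, Ω i) :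
    X.condExpect S (fun x => h x * f x) y = h y * X.condExpect S f y := by
  rw [condExpect_eq_div, condExpect_eq_div, ← mul_div_assoc, ← expect_const_mul]
  congr 2
  funext x
  by_cases hx : AgreeOn S x y
  · rw [hh x y hx]; ring
  · simp [cylinder, hx]

theorem condExpect_congr (X : PartiteComplex Ω) (S : Finset (Fin d)) {f g : (∀ i, Ω i) → ℝ}
    {y : ∀ i, Ω i} (h : ∀ x, X.IsFace x → AgreeOn S x y → f x = g x) :
    X.condExpect S f y = X.condExpect S g y := by
  rw [condExpect_eq_div, condExpect_eq_div]
  congr 1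
  refine X.expect_congr fun x hx => ?_
  by_cases hxy : AgreeOn S x y
  · rw [h x hx hxy]
  · simp [cylinder, hxy]

theorem condExpect_const (X : PartiteComplex Ω) (S : Finset (Fin d)) (c : ℝ) {y : ∀ i, Ω i}
    (hy : X.IsFace y) : X.condExpect S (fun _ => c) y = c := by
  rw [condExpect_eq_div]
  simp only [mul_comm _ c, expect_const_mul]
  exact mul_div_cancel_right₀ _ (X.expect_cylinder_pos S hy).ne'

theorem condExpect_of_dependsOnly (X : PartiteComplex Ω) {S : Finset (Fin d)}
    {h : (∀ i, Ω i) → ℝ} (hh : DependsOnly S h) {y : ∀ i, Ω i} (hy : X.IsFace y) :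
    X.condExpect S h y = h y := by
  have := X.condExpect_mul_left hh (fun _ => 1) y
  simpa [X.condExpect_const S 1 hy] using this

theorem condExpect_mono (X : PartiteComplex Ω) (S : Finset (Fin d)) {f g : (∀ i, Ω i) → ℝ}
    (h : ∀ x, X.IsFace x → f x ≤ g x) (y : ∀ i, Ω i) :
    X.condExpect S f y ≤ X.condExpect S g y := by
  have hc : ∀ x, 0 ≤ cylinder S y x := fun x => by
    unfold cylinder; split_ifs <;> norm_num
  rw [condExpect_eq_div, condExpect_eq_div]
  refine div_le_div_of_nonneg_right (X.expect_mono fun x hx => ?_)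
    (X.expect_nonneg fun x _ => hc x)
  exact mul_le_mul_of_nonneg_left (h x hx) (hc x)

/-- Self-adjointness: the kernel of `E_S` with respect to the weights is symmetric, since its
normalization depends only on the common restriction to `S`. -/
theorem expect_mul_condExpect (X : PartiteComplex Ω) (S : Finset (Fin d))
    (f g : (∀ i, Ω i) → ℝ) :
    (X.expect fun x => f x * X.condExpect S g x)
      = X.expect fun x => X.condExpect S f x * g x := by
  have e : ∀ a b : (∀ i, Ω i) → ℝ, (X.expect fun x => a x * X.condExpect S b x)
      = ∑ x, ∑ y, X.weight x * X.weight y * (cylinder S x y * (a x * b y))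
          / X.expect (cylinder S x) := fun a b => by
    refine Finset.sum_congr rfl fun x _ => ?_
    change X.weight x * (a x * X.condExpect S b x) = _
    rw [condExpect_eq_div, expect, ← mul_assoc, ← mul_div_assoc, Finset.mul_sum, Finset.sum_div]
    exact Finset.sum_congr rfl fun y _ => by ring
  simp only [mul_comm (X.condExpect S f _)]
  rw [e, e, Finset.sum_comm]
  refine Finset.sum_congr rfl fun y _ => Finset.sum_congr rfl fun x _ => ?_
  by_cases hxy : AgreeOn S x y
  · rw [cylinder_comm S y x, cylinder_congr hxy]; ring
  · have hyx : ¬AgreeOn S y x := fun h => hxy h.symm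
    simp [cylinder, hxy, hyx]

theorem expect_condExpect (X : PartiteComplex Ω) (S : Finset (Fin d)) (f : (∀ i, Ω i) → ℝ) :
    X.expect (X.condExpect S f) = X.expect f := by
  have h := X.expect_mul_condExpect S (fun _ => 1) f
  simp only [one_mul] at h
  rw [h]
  exact X.expect_congr fun x hx => by rw [X.condExpect_const S 1 hx, one_mul]

theorem expect_mul_condExpect_of_dependsOnly (X : PartiteComplex Ω) {S : Finset (Fin d)}
    {h : (∀ i, Ω i) → ℝ} (hh : DependsOnly S h) (f : (∀ i, Ω i) → ℝ) :
    (X.expect fun x => h x * X.condExpect S f x) = X.expect fun x => h x * f x := by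
  rw [expect_mul_condExpect]
  exact X.expect_congr fun x hx => by rw [X.condExpect_of_dependsOnly hh hx]

theorem condExpect_condExpect_of_subset (X : PartiteComplex Ω) {S T : Finset (Fin d)}
    (hST : S ⊆ T) (f : (∀ i, Ω i) → ℝ) :
    X.condExpect S (X.condExpect T f) = X.condExpect S f := by
  funext y
  rw [condExpect_eq_div, condExpect_eq_div,
    X.expect_mul_condExpect_of_dependsOnly ((dependsOnly_cylinder S y).mono hST)]

theorem condExpect_univ (X : PartiteComplex Ω) (f : (∀ i, Ω i) → ℝ) {y : ∀ i, Ω i}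
    (hy : X.IsFace y) : X.condExpect Finset.univ f y = f y :=
  X.condExpect_of_dependsOnly (fun _ _ h => congrArg f (funext fun i => h i (Finset.mem_univ i))) hy

theorem condExpect_empty (X : PartiteComplex Ω) (f : (∀ i, Ω i) → ℝ) (y : ∀ i, Ω i) :
    X.condExpect ∅ f y = X.expect f := by
  have h : cylinder (∅ : Finset (Fin d)) y = fun _ => 1 := by
    funext x; simp [cylinder, AgreeOn]
  rw [condExpect_eq_div, h]
  simp [expect_const]

/-- The averaging operator `E_S` as a linear map. -/
def avg (X : PartiteComplex Ω) (S : Finset (Fin d)) :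
    ((∀ i, Ω i) → ℝ) →ₗ[ℝ] ((∀ i, Ω i) → ℝ) where
  toFun := X.condExpect S
  map_add' f g := by
    funext y
    simp only [Pi.add_apply, condExpect_eq_div, mul_add, expect_add, add_div]
  map_smul' c f := by
    funext y
    simp only [Pi.smul_apply, smul_eq_mul, condExpect_eq_div, RingHom.id_apply,
      mul_left_comm _ c, expect_const_mul, mul_div_assoc]

theorem avg_apply (X : PartiteComplex Ω) (S : Finset (Fin d)) (f : (∀ i, Ω i) → ℝ) :
    X.avg S f = X.condExpect S f := rfl

theorem avg_avg_of_subset (X : PartiteComplex Ω) {S T : Finset (Fin d)}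
    (hST : S ⊆ T) (f : (∀ i, Ω i) → ℝ) : X.avg S (X.avg T f) = X.avg S f :=
  X.condExpect_condExpect_of_subset hST f

/-- The Laplacian `L_i` as a linear map. -/
def lap (X : PartiteComplex Ω) (i : Fin d) : ((∀ i, Ω i) → ℝ) →ₗ[ℝ] ((∀ i, Ω i) → ℝ) :=
  LinearMap.id - X.avg (Finset.univ.erase i)

theorem lap_eq (X : PartiteComplex Ω) (i : Fin d) (f : (∀ i, Ω i) → ℝ) :
    X.lap i f = f - X.avg (Finset.univ.erase i) f := rfl

theorem lap_apply (X : PartiteComplex Ω) (i : Fin d) (f : (∀ i, Ω i) → ℝ) (x : ∀ i, Ω i) :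
    X.lap i f x = f x - X.avg (Finset.univ.erase i) f x := rfl

theorem expect_mul_avg (X : PartiteComplex Ω) (S : Finset (Fin d)) (f g : (∀ i, Ω i) → ℝ) :
    (X.expect fun x => f x * X.avg S g x) = X.expect fun x => X.avg S f x * g x :=
  X.expect_mul_condExpect S f g

theorem expect_avg_sq (X : PartiteComplex Ω) (S : Finset (Fin d)) (f : (∀ i, Ω i) → ℝ) :
    (X.expect fun x => X.avg S f x ^ 2) = X.expect fun x => f x * X.avg S f x := by
  simp only [pow_two, mul_comm (f _)]
  exact X.expect_mul_condExpect_of_dependsOnly (X.dependsOnly_condExpect S f) f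

theorem expect_mul_lap_of_dependsOnly (X : PartiteComplex Ω) {i : Fin d}
    {h : (∀ i, Ω i) → ℝ} (hh : DependsOnly (Finset.univ.erase i) h) (f : (∀ i, Ω i) → ℝ) :
    (X.expect fun x => h x * X.lap i f x) = 0 := by
  simp only [lap_apply, mul_sub, expect_sub]
  exact sub_eq_zero.2 (X.expect_mul_condExpect_of_dependsOnly hh f).symm

theorem expect_avg_sq_add_lap_sq (X : PartiteComplex Ω) (i : Fin d) (f : (∀ i, Ω i) → ℝ) :
    (X.expect fun x => X.avg (Finset.univ.erase i) f x ^ 2) + (X.expect fun x => X.lap i f x ^ 2)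
      = X.expect fun x => f x ^ 2 := by
  have h := X.expect_mul_lap_of_dependsOnly (X.dependsOnly_condExpect (Finset.univ.erase i) f) f
  have e : (X.expect fun x => f x ^ 2) = X.expect fun x =>
      (X.avg (Finset.univ.erase i) f x ^ 2 + X.lap i f x ^ 2)
        + 2 * (X.condExpect (Finset.univ.erase i) f x * X.lap i f x) :=
    X.expect_congr fun x _ => by rw [lap_apply, avg_apply]; ring
  rw [e, expect_add, expect_add, expect_const_mul, h]
  ring

theorem expect_lap_sq (X : PartiteComplex Ω) (i : Fin d) (f : (∀ i, Ω i) → ℝ) :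
    (X.expect fun x => X.lap i f x ^ 2) = X.expect fun x => f x * X.lap i f x := by
  have h := X.expect_mul_lap_of_dependsOnly (X.dependsOnly_condExpect (Finset.univ.erase i) f) f
  have e : (X.expect fun x => X.lap i f x ^ 2) = X.expect fun x =>
      f x * X.lap i f x - X.condExpect (Finset.univ.erase i) f x * X.lap i f x :=
    X.expect_congr fun x _ => by rw [lap_apply, avg_apply]; ring
  rw [e, expect_sub, h, sub_zero]

theorem norm2_avg_le (X : PartiteComplex Ω) (S : Finset (Fin d)) (f : (∀ i, Ω i) → ℝ) :
    X.norm2 (X.avg S f) ≤ X.norm2 f := by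
  refine X.norm2_le_of_sq_le (X.norm2_nonneg f) ?_
  rw [norm2_sq]
  have h : 0 ≤ X.expect fun x => (f x - X.avg S f x) ^ 2 := X.expect_nonneg fun _ _ => sq_nonneg _
  have e : (X.expect fun x => (f x - X.avg S f x) ^ 2) = X.expect fun x =>
      (f x ^ 2 + X.avg S f x ^ 2) - 2 * (f x * X.avg S f x) :=
    X.expect_congr fun x _ => by ring
  rw [e, expect_sub, expect_add, expect_const_mul, ← expect_avg_sq] at h
  linarith

/-! ### Links and approximate commutation -/

theorem link_weight (X : PartiteComplex Ω) (S : Finset (Fin d)) {z : ∀ i, Ω i}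
    (hz : X.IsFace z) (x : ∀ i, Ω i) :
    (X.link S z hz).weight x = cylinder S z x * X.weight x / X.expect (cylinder S z) := by
  simp only [link, cylinder, prob_eq_expect, ite_mul, one_mul, zero_mul]
  rfl

theorem link_expect (X : PartiteComplex Ω) (S : Finset (Fin d)) {z : ∀ i, Ω i}
    (hz : X.IsFace z) (h : (∀ i, Ω i) → ℝ) :
    (X.link S z hz).expect h = X.condExpect S h z := by
  rw [condExpect_eq_div, expect, expect, Finset.sum_div]
  refine Finset.sum_congr rfl fun x _ => ?_
  rw [link_weight]
  ring

theorem IsFace.of_link {X : PartiteComplex Ω} {S : Finset (Fin d)} {z : ∀ i, Ω i}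
    {hz : X.IsFace z} {y : ∀ i, Ω i} (hy : (X.link S z hz).IsFace y) :
    X.IsFace y ∧ AgreeOn S y z := by
  have h : AgreeOn S y z := by
    by_contra h
    rw [IsFace, link_weight] at hy
    simp [cylinder, h] at hy
  refine ⟨(X.weight_nonneg y).lt_of_ne fun h0 => ?_, h⟩
  rw [IsFace, link_weight, ← h0] at hy
  simp at hy

theorem cylinder_mul_cylinder {S T : Finset (Fin d)} {y z : ∀ i, Ω i} (h : AgreeOn S y z)
    (x : ∀ i, Ω i) : cylinder T y x * cylinder S z x = cylinder (T ∪ S) y x := by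
  rw [← cylinder_congr h]
  have : AgreeOn (T ∪ S) x y ↔ AgreeOn T x y ∧ AgreeOn S x y := by
    simp only [AgreeOn, Finset.mem_union]
    exact ⟨fun h => ⟨fun i hi => h i (.inl hi), fun i hi => h i (.inr hi)⟩,
      fun h i hi => hi.elim (h.1 i) (h.2 i)⟩
  by_cases h1 : AgreeOn T x y <;> by_cases h2 : AgreeOn S x y <;> simp [cylinder, this, h1, h2]

theorem link_condExpect (X : PartiteComplex Ω) (S T : Finset (Fin d)) {z : ∀ i, Ω i}
    (hz : X.IsFace z) (h : (∀ i, Ω i) → ℝ) {y : ∀ i, Ω i} (hy : AgreeOn S y z) :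
    (X.link S z hz).condExpect T h y = X.condExpect (T ∪ S) h y := by
  have e : ∀ g : (∀ i, Ω i) → ℝ, (X.link S z hz).expect (fun x => cylinder T y x * g x)
      = (X.expect fun x => cylinder (T ∪ S) y x * g x) / X.expect (cylinder S z) := fun g => by
    rw [link_expect, condExpect_eq_div]
    congr 2
    funext x
    rw [← cylinder_mul_cylinder hy]
    ring
  have e1 := e fun _ => 1
  simp only [mul_one] at e1
  rw [condExpect_eq_div, condExpect_eq_div, e,
    show (X.link S z hz).expect (cylinder T y) = _ from e1,
    div_div_div_cancel_right₀ (X.expect_cylinder_pos S hz).ne']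

/-- In the link of `z_S` the function `g` depends on `x_j` alone, and `E_{S ∪ {i}} g` becomes the
walk from color `j` to color `i`. Squaring its expansion and averaging over `z` gives the bound. -/
theorem IsGammaProduct.norm2_avg_insert_sub_avg_le_of_dependsOnly {X : PartiteComplex Ω} {γ : ℝ}
    (hX : X.IsGammaProduct γ) (hγ : 0 ≤ γ) {S : Finset (Fin d)} {i j : Fin d} (hi : i ∉ S)
    (hj : j ∉ S) (hij : i ≠ j) {g : (∀ i, Ω i) → ℝ} (hg : DependsOnly (insert j S) g) :
    X.norm2 (X.avg (insert i S) g - X.avg S g) ≤ γ * X.norm2 g := by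
  refine X.norm2_le_of_sq_le (mul_nonneg hγ (X.norm2_nonneg g)) ?_
  rw [mul_pow, norm2_sq, ← X.expect_condExpect S, ← X.expect_condExpect S fun x => g x ^ 2,
    ← expect_const_mul]
  refine X.expect_mono fun z hz => ?_
  classical
  set g' : Ω j → ℝ := fun v => g (Function.update z j v) with hg'
  have hgg : ∀ x, AgreeOn S x z → g' (x j) = g x := fun x hx => by
    refine hg _ _ fun k hk => ?_
    by_cases hkj : k = j
    · subst hkj; simp
    · rw [Function.update_of_ne hkj]
      exact (hx k ((Finset.mem_insert.1 hk).resolve_left hkj)).symm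
  have hw := (X.link S z hz).expect_sq_le_of_norm2_le (hX S z hz j i hj hi hij.symm g')
  have e : (X.link S z hz).expect (fun x => g' (x j) ^ 2) = X.condExpect S (fun x => g x ^ 2) z := by
    rw [link_expect]
    exact X.condExpect_congr S fun x _ hx => by rw [hgg x hx]
  rw [mul_pow, norm2_sq, e] at hw
  refine le_trans (le_of_eq ?_) hw
  rw [← link_expect _ _ hz]
  refine (X.link S z hz).expect_congr fun y hy => ?_
  obtain ⟨hyf, hyz⟩ := IsFace.of_link hy
  rw [walk, link_condExpect X S {i} hz _ hyz, link_expect, Pi.sub_apply, avg_apply, avg_apply,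
    ← Finset.insert_eq, X.dependsOnly_condExpect S g y z hyz]
  congr 2
  · exact X.condExpect_congr _ fun x _ hx =>
      (hgg x ((hx.mono (Finset.subset_insert i S)).trans hyz)).symm
  · exact X.condExpect_congr _ fun x _ hx => (hgg x hx).symm

/-- Conditioning on all the other coordinates makes `x_i` irrelevant to `g`. Removing these
coordinates one at a time costs `γ` each. -/
theorem IsGammaProduct.norm2_avg_insert_sub_avg_le {X : PartiteComplex Ω} {γ : ℝ}
    (hX : X.IsGammaProduct γ) (hγ : 0 ≤ γ) {i : Fin d} {g : (∀ i, Ω i) → ℝ}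
    (hg : DependsOnly (Finset.univ.erase i) g) (U : Finset (Fin d)) (hi : i ∉ U) :
    X.norm2 (X.avg (insert i U) g - X.avg U g) ≤ ((insert i U)ᶜ.card * γ) * X.norm2 g := by
  induction hn : (insert i U)ᶜ.card generalizing U with
  | zero =>
    have hT : insert i U = Finset.univ := by
      rwa [Finset.card_eq_zero, Finset.compl_eq_empty_iff] at hn
    have hU : U = Finset.univ.erase i := by rw [← hT, Finset.erase_insert hi]
    rw [X.norm2_congr (g := 0), norm2_zero]
    · simp
    · intro x hx
      rw [Pi.sub_apply, hT, avg_apply, avg_apply, X.condExpect_univ g hx, hU,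
        X.condExpect_of_dependsOnly hg hx]
      simp
  | succ n ih =>
    obtain ⟨j, hj⟩ : (insert i U)ᶜ.Nonempty := Finset.card_pos.1 (by omega)
    rw [Finset.mem_compl] at hj
    have hji : j ≠ i := fun h => hj (h ▸ Finset.mem_insert_self i U)
    have hjU : j ∉ U := fun h => hj (Finset.mem_insert_of_mem h)
    have hi' : i ∉ insert j U := by simp [hi, hji.symm]
    have h1 := ih (insert j U) hi' (by
      rw [Finset.insert_comm, Finset.compl_insert, Finset.card_erase_of_mem (by simpa using hj), hn]
      rfl)
    have h2 := hX.norm2_avg_insert_sub_avg_le_of_dependsOnly hγ hi hjU hji.symm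
      (X.dependsOnly_condExpect (insert j U) g)
    rw [← avg_apply] at h2
    have e : X.avg (insert i U) g - X.avg U g
        = X.avg (insert i U) (X.avg (insert i (insert j U)) g - X.avg (insert j U) g)
          + (X.avg (insert i U) (X.avg (insert j U) g) - X.avg U (X.avg (insert j U) g)) := by
      rw [map_sub, X.avg_avg_of_subset (Finset.insert_subset_insert i (Finset.subset_insert j U)),
        X.avg_avg_of_subset (Finset.subset_insert j U)]
      abel
    rw [e]
    refine (X.norm2_add_le _ _).trans ?_
    have h3 := X.norm2_avg_le (insert i U)
      (X.avg (insert i (insert j U)) g - X.avg (insert j U) g)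
    have h4 := mul_le_mul_of_nonneg_left (X.norm2_avg_le (insert j U) g) hγ
    push_cast
    linarith

/-- Averaging over coordinate `i` approximately commutes with `E_{U ∪ {i}}`. -/
theorem IsGammaProduct.norm2_avg_insert_avg_sub_avg_le {X : PartiteComplex Ω} {γ : ℝ}
    (hX : X.IsGammaProduct γ) (hγ : 0 ≤ γ) {i : Fin d} (f : (∀ i, Ω i) → ℝ)
    {U : Finset (Fin d)} (hi : i ∉ U) :
    X.norm2 (X.avg (insert i U) (X.avg (Finset.univ.erase i) f) - X.avg U f)
      ≤ (d * γ) * X.norm2 f := by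
  have h := hX.norm2_avg_insert_sub_avg_le hγ
    (X.dependsOnly_condExpect (Finset.univ.erase i) f) U hi
  rw [← avg_apply, X.avg_avg_of_subset (T := Finset.univ.erase i) fun k hk =>
    Finset.mem_erase.2 ⟨fun h => hi (h ▸ hk), Finset.mem_univ k⟩] at h
  refine h.trans (mul_le_mul (mul_le_mul_of_nonneg_right ?_ hγ) (X.norm2_avg_le _ f)
    (X.norm2_nonneg _) (by positivity))
  exact_mod_cast (Finset.card_le_univ _).trans_eq (Fintype.card_fin d)

end PartiteComplex

end

noncomputable section

/-! ### Fourier analysis on the discrete cube -/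

namespace SignCube

variable {ι : Type*} [Fintype ι] [DecidableEq ι]

/-- The sign `±1` encoded by a Boolean. -/
def sign (b : Bool) : ℝ := if b then 1 else -1

theorem sign_sq (b : Bool) : sign b ^ 2 = 1 := by cases b <;> norm_num [sign]

theorem sign_not (b : Bool) : sign (!b) = -sign b := by cases b <;> norm_num [sign]

theorem abs_sign (b : Bool) : |sign b| = 1 := by cases b <;> norm_num [sign]

/-- The expectation over uniform signs. -/
def mean (h : (ι → Bool) → ℝ) : ℝ := (∑ r, h r) / Fintype.card (ι → Bool)

theorem mean_add (h h' : (ι → Bool) → ℝ) : mean (fun r => h r + h' r) = mean h + mean h' := by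
  simp only [mean, Finset.sum_add_distrib, add_div]

theorem mean_const_mul (c : ℝ) (h : (ι → Bool) → ℝ) :
    mean (fun r => c * h r) = c * mean h := by
  simp only [mean, ← Finset.mul_sum, mul_div_assoc]

theorem mean_const (c : ℝ) : mean (fun _ : ι → Bool => c) = c := by
  have : (Fintype.card (ι → Bool) : ℝ) ≠ 0 := by
    exact_mod_cast Fintype.card_ne_zero
  rw [mean, Finset.sum_const, Finset.card_univ, nsmul_eq_mul, mul_div_cancel_left₀ _ this]

theorem mean_mono {h h' : (ι → Bool) → ℝ} (hh : ∀ r, h r ≤ h' r) : mean h ≤ mean h' :=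
  div_le_div_of_nonneg_right (Finset.sum_le_sum fun r _ => hh r) (Nat.cast_nonneg _)

theorem mean_nonneg {h : (ι → Bool) → ℝ} (hh : ∀ r, 0 ≤ h r) : 0 ≤ mean h :=
  div_nonneg (Finset.sum_nonneg fun r _ => hh r) (Nat.cast_nonneg _)

theorem mean_mul_sq_le (h h' : (ι → Bool) → ℝ) :
    mean (fun r => h r * h' r) ^ 2 ≤ mean (fun r => h r ^ 2) * mean (fun r => h' r ^ 2) := by
  have := Finset.sum_mul_sq_le_sq_mul_sq Finset.univ h h'
  simp only [mean]
  rw [div_pow, div_mul_div_comm, ← pow_two]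
  exact div_le_div_of_nonneg_right this (sq_nonneg _)

/-- `∑_{S ⊆ A} c_S r^S`. -/
def walsh (A : Finset ι) (c : Finset ι → ℝ) (r : ι → Bool) : ℝ :=
  ∑ S ∈ A.powerset, (∏ i ∈ S, sign (r i)) * c S

theorem walsh_insert {a : ι} {A : Finset ι} (ha : a ∉ A) (c : Finset ι → ℝ) (r : ι → Bool) :
    walsh (insert a A) c r = walsh A c r + sign (r a) * walsh A (fun S => c (insert a S)) r := by
  rw [walsh, Finset.sum_powerset_insert ha, walsh, walsh, Finset.mul_sum]
  congr 1
  refine Finset.sum_congr rfl fun S hS => ?_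
  rw [Finset.prod_insert fun h => ha (Finset.mem_powerset.1 hS h), mul_assoc]

/-- Flipping one sign. -/
def flip (a : ι) (r : ι → Bool) : ι → Bool := Function.update r a (!r a)

theorem flip_involutive (a : ι) : Function.Involutive (flip a) := by
  intro r
  simp [flip]

theorem walsh_flip {a : ι} {A : Finset ι} (ha : a ∉ A) (c : Finset ι → ℝ) (r : ι → Bool) :
    walsh A c (flip a r) = walsh A c r := by
  refine Finset.sum_congr rfl fun S hS => ?_
  congr 1
  refine Finset.prod_congr rfl fun i hi => ?_
  have : i ≠ a := fun h => ha (h ▸ Finset.mem_powerset.1 hS hi)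
  simp [flip, this]

theorem mean_sign_mul {a : ι} {h : (ι → Bool) → ℝ} (hh : ∀ r, h (flip a r) = h r) :
    mean (fun r => sign (r a) * h r) = 0 := by
  have e : ∑ r, sign (r a) * h r = ∑ r, -(sign (r a) * h r) := by
    rw [← Equiv.sum_comp (flip_involutive a).toPerm]
    refine Finset.sum_congr rfl fun r _ => ?_
    simp only [Function.Involutive.coe_toPerm, hh]
    simp [flip, sign_not]
  rw [Finset.sum_neg_distrib] at e
  rw [mean, show ∑ r, sign (r a) * h r = 0 by linarith, zero_div]

theorem mean_walsh_mul_walsh (A : Finset ι) (c c' : Finset ι → ℝ) :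
    mean (fun r => walsh A c r * walsh A c' r) = ∑ S ∈ A.powerset, c S * c' S := by
  induction A using Finset.induction_on generalizing c c' with
  | empty => simp [walsh, mean_const]
  | insert a A ha ih =>
    rw [Finset.sum_powerset_insert ha, ← ih, ← ih, ← mean_add]
    have h0 := mean_sign_mul (a := a) (h := fun r =>
      walsh A c r * walsh A (fun S => c' (insert a S)) r
        + walsh A (fun S => c (insert a S)) r * walsh A c' r)
      fun r => by simp only [walsh_flip ha]
    refine Eq.trans ?_ (add_zero _)
    rw [← h0, ← mean_add]
    congr 1
    funext r
    rw [walsh_insert ha, walsh_insert ha]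
    linear_combination walsh A (fun S => c (insert a S)) r
      * walsh A (fun S => c' (insert a S)) r * sign_sq (r a)

/-- The `(2, 4)` hypercontractive inequality for polynomials of degree at most `k`. -/
theorem mean_walsh_pow_four_le (A : Finset ι) (k : ℕ) (c : Finset ι → ℝ)
    (hc : ∀ S ⊆ A, k < S.card → c S = 0) :
    mean (fun r => walsh A c r ^ 4) ≤ 9 ^ k * (∑ S ∈ A.powerset, c S ^ 2) ^ 2 := by
  induction A using Finset.induction_on generalizing c k with
  | empty =>
    simp only [walsh, Finset.powerset_empty, Finset.sum_singleton, Finset.prod_empty, one_mul,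
      mean_const]
    nlinarith [one_le_pow₀ (M₀ := ℝ) (a := 9) (by norm_num) (n := k), sq_nonneg (c ∅ ^ 2)]
  | insert a A ha ih =>
    have hq := ih k c fun S hS => hc S (hS.trans (Finset.subset_insert a A))
    have hcard : ∀ S ⊆ A, (insert a S).card = S.card + 1 := fun S hS =>
      Finset.card_insert_of_notMem fun h => ha (hS h)
    rw [Finset.sum_powerset_insert ha]
    rcases k with _ | k
    · have hz : ∀ S ∈ A.powerset, c (insert a S) = 0 := fun S hS => by
        rw [Finset.mem_powerset] at hS
        exact hc _ (Finset.insert_subset_insert a hS) (by rw [hcard S hS]; omega)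
      have hw : ∀ r, walsh (insert a A) c r = walsh A c r := fun r => by
        rw [walsh_insert ha]
        have : walsh A (fun S => c (insert a S)) r = 0 :=
          Finset.sum_eq_zero fun S hS => mul_eq_zero_of_right _ (hz S hS)
        rw [this, mul_zero, add_zero]
      rw [Finset.sum_eq_zero (s := A.powerset) (f := fun S => c (insert a S) ^ 2)
        fun S hS => by rw [hz S hS]; norm_num]
      simpa only [hw, add_zero] using hq
    · have hs := ih k (fun S => c (insert a S)) fun S hS hk =>
        hc _ (Finset.insert_subset_insert a hS) (by rw [hcard S hS]; omega)
      set q := walsh A c with hqdef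
      set s := walsh A (fun S => c (insert a S)) with hsdef
      set Q := ∑ S ∈ A.powerset, c S ^ 2
      set R := ∑ S ∈ A.powerset, c (insert a S) ^ 2
      have hQ : 0 ≤ Q := Finset.sum_nonneg fun _ _ => sq_nonneg _
      have hR : 0 ≤ R := Finset.sum_nonneg fun _ _ => sq_nonneg _
      have h9 : (0 : ℝ) < 9 ^ k := by positivity
      -- Cauchy–Schwarz gives the geometric mean of `9^(k+1)` and `9^k`, because `s` has degree one
      -- lower. The coefficient `6 * 3 * 9^k = 2 * 9^(k+1)` then matches the cross term of `(Q +
      -- R)^2` exactly.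
      have hcross : mean (fun r => q r ^ 2 * s r ^ 2) ≤ 3 * 9 ^ k * (Q * R) := by
        have h1 := mean_mul_sq_le (fun r => q r ^ 2) (fun r => s r ^ 2)
        simp only [← pow_mul] at h1
        norm_num at h1
        refine le_of_sq_le_sq ?_ (by positivity)
        refine h1.trans ((mul_le_mul hq hs (mean_nonneg fun r => by positivity)
          (by positivity)).trans_eq ?_)
        rw [pow_succ]; ring
      have h0 := mean_sign_mul (a := a) (h := fun r => 4 * (q r ^ 3 * s r) + 4 * (q r * s r ^ 3))
        fun r => by simp only [hqdef, hsdef, walsh_flip ha]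
      have e : mean (fun r => walsh (insert a A) c r ^ 4)
          = mean (fun r => q r ^ 4) + 6 * mean (fun r => q r ^ 2 * s r ^ 2)
            + mean (fun r => s r ^ 4) := by
        rw [← mean_const_mul, ← mean_add, ← mean_add]
        refine Eq.trans ?_ (add_zero _)
        rw [← h0, ← mean_add]
        congr 1
        funext r
        rw [walsh_insert ha]
        linear_combination (6 * q r ^ 2 * s r ^ 2 + 4 * q r * s r ^ 3 * sign (r a)
          + s r ^ 4 * (sign (r a) ^ 2 + 1)) * sign_sq (r a)
      rw [e]
      rw [pow_succ] at hq ⊢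
      nlinarith [mul_nonneg h9.le (sq_nonneg R), mul_nonneg h9.le (mul_nonneg hQ hR)]

theorem sum_sq_sq_le_mean_walsh_pow_four (A : Finset ι) (c : Finset ι → ℝ) :
    (∑ S ∈ A.powerset, c S ^ 2) ^ 2 ≤ mean (fun r => walsh A c r ^ 4) := by
  have h := mean_mul_sq_le (fun r => walsh A c r ^ 2) (fun _ => 1)
  have e := mean_walsh_mul_walsh A c c
  simp only [← pow_two] at e
  simp only [e, mul_one, one_pow, mean_const, ← pow_mul] at h
  exact h

/-- The dual `(4/3, 2)` hypercontractive inequality for the part of degree at most `k` of a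
function `v ^ 3`. -/
theorem sum_sq_sq_le_of_walsh_eq_cube (A : Finset ι) (k : ℕ) (c : Finset ι → ℝ)
    (p : Finset ι → Prop) [DecidablePred p] (hp : ∀ S ⊆ A, p S → S.card ≤ k)
    (v : (ι → Bool) → ℝ) (hv : ∀ r, walsh A c r = v r ^ 3) :
    (∑ S ∈ A.powerset with p S, c S ^ 2) ^ 2 ≤ 9 ^ k * mean (fun r => v r ^ 4) ^ 3 := by
  set c' : Finset ι → ℝ := fun S => if p S then c S else 0
  set B := ∑ S ∈ A.powerset with p S, c S ^ 2 with hB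
  set V := mean fun r => v r ^ 4
  have hB0 : 0 ≤ B := Finset.sum_nonneg fun _ _ => sq_nonneg _
  have hV0 : 0 ≤ V := mean_nonneg fun r => by positivity
  have h4 := mean_walsh_pow_four_le A k c' fun S hS hk => if_neg fun h => by
    have := hp S hS h; omega
  have e1 : ∑ S ∈ A.powerset, c' S ^ 2 = B := by
    rw [hB, Finset.sum_filter]
    exact Finset.sum_congr rfl fun S _ => by by_cases h : p S <;> simp [c', h]
  have e2 : mean (fun r => walsh A c' r * v r ^ 3) = B := by
    simp only [← hv]
    rw [mean_walsh_mul_walsh, ← e1]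
    exact Finset.sum_congr rfl fun S _ => by by_cases h : p S <;> simp [c', h, pow_two]
  rw [e1] at h4
  -- Two applications of Cauchy–Schwarz replace Hölder with exponents `4` and `4/3`: `B^4` is at
  -- most the fourth moment of the truncated polynomial times `V^3`.
  have h1 := mean_mul_sq_le (fun r => walsh A c' r * v r) (fun r => v r ^ 2)
  have h2 := mean_mul_sq_le (fun r => walsh A c' r ^ 2) (fun r => v r ^ 2)
  simp only [← pow_mul, mul_pow] at h1 h2
  norm_num at h1 h2
  have e3 : mean (fun r => walsh A c' r * v r * v r ^ 2) = B := by
    rw [← e2]; congr 1; funext r; ring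
  rw [e3] at h1
  change B ^ 2 ≤ mean (fun r => walsh A c' r ^ 2 * v r ^ 2) * V at h1
  change mean (fun r => walsh A c' r ^ 2 * v r ^ 2) ^ 2 ≤ mean (fun r => walsh A c' r ^ 4) * V at h2
  have h3 : B ^ 4 ≤ B ^ 2 * (9 ^ k * V ^ 3) :=
    calc B ^ 4 = (B ^ 2) ^ 2 := by ring
      _ ≤ (mean (fun r => walsh A c' r ^ 2 * v r ^ 2) * V) ^ 2 := by gcongr
      _ = mean (fun r => walsh A c' r ^ 2 * v r ^ 2) ^ 2 * V ^ 2 := by ring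
      _ ≤ (mean (fun r => walsh A c' r ^ 4) * V) * V ^ 2 := by gcongr
      _ ≤ (9 ^ k * B ^ 2 * V) * V ^ 2 := by gcongr
      _ = _ := by ring
  rcases hB0.eq_or_lt with h | h
  · rw [← h, zero_pow two_ne_zero]; positivity
  · exact le_of_mul_le_mul_left (by linarith [h3, show B ^ 4 = B ^ 2 * B ^ 2 by ring])
      (show 0 < B ^ 2 by positivity)

end SignCube

end

/-! ### Cube roots: since `cubeRoot x ^ 4 = |x|^{4/3}`, they express `4/3`-norms by integer powers.
-/

noncomputable section

/-- The real cube root. -/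
def cubeRoot (x : ℝ) : ℝ := SignType.sign x * |x| ^ (1 / 3 : ℝ)

theorem cubeRoot_pow_three (x : ℝ) : cubeRoot x ^ 3 = x := by
  have h : (|x| ^ (1 / 3 : ℝ)) ^ 3 = |x| := by
    rw [← Real.rpow_natCast, ← Real.rpow_mul (abs_nonneg x)]
    norm_num
  have hs : ((SignType.sign x : SignType) : ℝ) ^ 3 = SignType.sign x := by
    rcases lt_trichotomy x 0 with h | h | h <;> simp [h]; norm_num
  rw [cubeRoot, mul_pow, h, hs, sign_mul_abs]

theorem cubeRoot_pow_four_le {x : ℝ} (hx : |x| ≤ 2) : cubeRoot x ^ 4 ≤ 2 * |x| := by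
  set v := cubeRoot x with hv
  have h3 : v ^ 3 = x := cubeRoot_pow_three x
  have habs : |v| ^ 3 = |x| := by rw [← abs_pow, h3]
  have hv2 : |v| ≤ 2 := by
    by_contra h
    push Not at h
    nlinarith [pow_lt_pow_left₀ h (by norm_num) (three_ne_zero)]
  calc v ^ 4 = |v| ^ 3 * |v| := by rw [← pow_succ]; exact (Even.pow_abs (by decide) v).symm
    _ ≤ |x| * 2 := by rw [habs]; gcongr
    _ = 2 * |x| := mul_comm _ _

namespace PartiteComplex

variable {d : ℕ} {Ω : Fin d → Type u} [∀ i, Fintype (Ω i)]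

/-! ### Ordered Efron–Stein pieces -/

/-- The ordered product over the list `l` of `L_i` for `i ∈ S` and `E_{[d] ∖ {i}}` for `i ∉ S`;
the head of the list is applied first. -/
def piece (X : PartiteComplex Ω) (S : Finset (Fin d)) :
    List (Fin d) → ((∀ i, Ω i) → ℝ) →ₗ[ℝ] ((∀ i, Ω i) → ℝ)
  | [] => LinearMap.id
  | i :: l => piece X S l ∘ₗ (if i ∈ S then X.lap i else X.avg (Finset.univ.erase i))

theorem piece_cons_of_mem (X : PartiteComplex Ω) {S : Finset (Fin d)} {i : Fin d} (hi : i ∈ S)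
    (l : List (Fin d)) (f : (∀ i, Ω i) → ℝ) :
    X.piece S (i :: l) f = X.piece S l (X.lap i f) := by
  simp [piece, hi]

theorem piece_cons_of_notMem (X : PartiteComplex Ω) {S : Finset (Fin d)} {i : Fin d}
    (hi : i ∉ S) (l : List (Fin d)) (f : (∀ i, Ω i) → ℝ) :
    X.piece S (i :: l) f = X.piece S l (X.avg (Finset.univ.erase i) f) := by
  simp [piece, hi]

theorem piece_insert_of_notMem (X : PartiteComplex Ω) (S : Finset (Fin d)) {i : Fin d}
    {l : List (Fin d)} (hi : i ∉ l) : X.piece (insert i S) l = X.piece S l := by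
  induction l with
  | nil => rfl
  | cons j l ih =>
    rw [List.mem_cons, not_or] at hi
    simp [piece, ih hi.2, Ne.symm hi.1]

/-- The one-coordinate noise operator `E_{[d] ∖ {i}} + t L_i`. -/
def noiseStep (X : PartiteComplex Ω) (i : Fin d) (t : ℝ) :
    ((∀ i, Ω i) → ℝ) →ₗ[ℝ] ((∀ i, Ω i) → ℝ) :=
  X.avg (Finset.univ.erase i) + t • X.lap i

theorem noiseStep_apply (X : PartiteComplex Ω) (i : Fin d) (t : ℝ) (f : (∀ i, Ω i) → ℝ)
    (x : ∀ i, Ω i) :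
    X.noiseStep i t f x = X.avg (Finset.univ.erase i) f x + t * X.lap i f x := rfl

/-- The ordered product of noise operators with parameters `s i`. -/
def noise (X : PartiteComplex Ω) (s : Fin d → ℝ) :
    List (Fin d) → ((∀ i, Ω i) → ℝ) →ₗ[ℝ] ((∀ i, Ω i) → ℝ)
  | [] => LinearMap.id
  | i :: l => noise X s l ∘ₗ X.noiseStep i (s i)

theorem noise_cons (X : PartiteComplex Ω) (s : Fin d → ℝ) (i : Fin d) (l : List (Fin d))
    (f : (∀ i, Ω i) → ℝ) : X.noise s (i :: l) f = X.noise s l (X.noiseStep i (s i) f) := rfl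

theorem noise_eq_sum_piece (X : PartiteComplex Ω) (s : Fin d → ℝ) {l : List (Fin d)}
    (hl : l.Nodup) (f : (∀ i, Ω i) → ℝ) :
    X.noise s l f = ∑ S ∈ l.toFinset.powerset, (∏ i ∈ S, s i) • X.piece S l f := by
  induction l generalizing f with
  | nil => simp [noise, piece]
  | cons i l ih =>
    rw [List.nodup_cons] at hl
    have hi : i ∉ l.toFinset := by simpa using hl.1
    have hS : ∀ S ∈ l.toFinset.powerset, i ∉ S := fun S hS h => hi (Finset.mem_powerset.1 hS h)
    rw [noise_cons, noiseStep, LinearMap.add_apply, LinearMap.smul_apply, map_add, map_smul,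
      ih hl.2, ih hl.2, List.toFinset_cons, Finset.sum_powerset_insert hi, Finset.smul_sum]
    congr 1 <;> refine Finset.sum_congr rfl fun S h => ?_
    · rw [X.piece_cons_of_notMem (hS S h)]
    · rw [X.piece_cons_of_mem (Finset.mem_insert_self i S), X.piece_insert_of_notMem S hl.1,
        Finset.prod_insert (hS S h), mul_smul]

/-- An exact Parseval identity without commutation: each operator splits the function orthogonally
into its average and its Laplacian, and induction treats the two halves separately. -/
theorem sum_expect_piece_sq (X : PartiteComplex Ω) {l : List (Fin d)} (hl : l.Nodup)
    (f : (∀ i, Ω i) → ℝ) :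
    ∑ S ∈ l.toFinset.powerset, (X.expect fun x => X.piece S l f x ^ 2)
      = X.expect fun x => f x ^ 2 := by
  induction l generalizing f with
  | nil => simp [piece]
  | cons i l ih =>
    rw [List.nodup_cons] at hl
    have hi : i ∉ l.toFinset := by simpa using hl.1
    have hS : ∀ S ∈ l.toFinset.powerset, i ∉ S := fun S hS h => hi (Finset.mem_powerset.1 hS h)
    rw [List.toFinset_cons, Finset.sum_powerset_insert hi, ← X.expect_avg_sq_add_lap_sq i f,
      ← ih hl.2, ← ih hl.2]
    congr 1 <;> refine Finset.sum_congr rfl fun S h => ?_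
    · rw [X.piece_cons_of_notMem (hS S h)]
    · rw [X.piece_cons_of_mem (Finset.mem_insert_self i S), X.piece_insert_of_notMem S hl.1]

/-! ### Contractivity of the noise operators -/

theorem expect_mul_noiseStep (X : PartiteComplex Ω) (i : Fin d) (t : ℝ)
    (f g : (∀ i, Ω i) → ℝ) :
    (X.expect fun x => f x * X.noiseStep i t g x) = X.expect fun x => X.noiseStep i t f x * g x := by
  have e : ∀ a b : (∀ i, Ω i) → ℝ, (X.expect fun x => a x * X.noiseStep i t b x)
      = (1 - t) * (X.expect fun x => a x * X.avg (Finset.univ.erase i) b x)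
        + t * (X.expect fun x => a x * b x) := fun a b => by
    rw [← expect_const_mul, ← expect_const_mul, ← expect_add]
    refine X.expect_congr fun x _ => ?_
    rw [noiseStep_apply, lap_apply]
    ring
  simp only [mul_comm (X.noiseStep i t f _)]
  rw [e, e, expect_mul_avg]
  simp only [mul_comm (g _)]

/-- The added term cancels the part linear in `b`. What remains is `b^2` times a quadratic form in
`(a, b)`, which is positive for `|t| ≤ 1/4`. -/
theorem pow_four_two_point_le {a b t : ℝ} (ht : |t| ≤ 1 / 4) :
    (a + t * b) ^ 4 + 4 * (1 - t) * (a ^ 3 * b) ≤ (a + b) ^ 4 := by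
  obtain ⟨h1, h2⟩ := abs_le.1 ht
  have t2 : t ^ 2 ≤ 1 / 16 := by nlinarith
  have t4 : t ^ 4 ≤ 1 / 16 := by nlinarith [sq_nonneg t]
  have t3 : |1 - t ^ 3| ≤ 65 / 64 := by
    rw [abs_le]; constructor <;> nlinarith [sq_nonneg t]
  have hab : -((65 / 64) * |a * b|) ≤ (1 - t ^ 3) * (a * b) := by
    have := neg_abs_le ((1 - t ^ 3) * (a * b))
    rw [abs_mul] at this
    nlinarith [mul_le_mul_of_nonneg_right t3 (abs_nonneg (a * b))]
  have hab2 : 2 * |a * b| ≤ 5 / 2 * a ^ 2 + 2 / 5 * b ^ 2 := by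
    rw [abs_mul, ← sq_abs a, ← sq_abs b]
    nlinarith [sq_nonneg (5 * |a| - 2 * |b|)]
  have key : 0 ≤ 6 * (1 - t ^ 2) * a ^ 2 + 4 * ((1 - t ^ 3) * (a * b)) + (1 - t ^ 4) * b ^ 2 := by
    nlinarith [sq_nonneg a, sq_nonneg b, mul_nonneg (sub_nonneg.2 t2) (sq_nonneg a),
      mul_nonneg (sub_nonneg.2 t4) (sq_nonneg b)]
  nlinarith [mul_nonneg (sq_nonneg b) key]

/-- The two-point inequality is applied with `a = E_{[d] ∖ {i}} f` and `b = L_i f`. Its linear term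
has mean zero because `a ^ 3` does not depend on coordinate `i`. -/
theorem expect_noiseStep_pow_four_le (X : PartiteComplex Ω) (i : Fin d) {t : ℝ}
    (ht : |t| ≤ 1 / 4) (f : (∀ i, Ω i) → ℝ) :
    (X.expect fun x => X.noiseStep i t f x ^ 4) ≤ X.expect fun x => f x ^ 4 := by
  have h0 := X.expect_mul_lap_of_dependsOnly (i := i)
    (h := fun x => X.avg (Finset.univ.erase i) f x ^ 3)
    (fun x y hxy => congrArg (· ^ 3) (X.dependsOnly_condExpect _ f x y hxy)) f
  have h1 : (X.expect fun x => X.noiseStep i t f x ^ 4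
      + 4 * (1 - t) * (X.avg (Finset.univ.erase i) f x ^ 3 * X.lap i f x))
      ≤ X.expect fun x => f x ^ 4 := X.expect_mono fun x _ => by
    have := pow_four_two_point_le (a := X.avg (Finset.univ.erase i) f x) (b := X.lap i f x) ht
    rw [noiseStep_apply]
    refine this.trans_eq ?_
    rw [lap_apply]
    ring
  rwa [expect_add, expect_const_mul, h0, mul_zero, add_zero] at h1

/-- Duality: with `T` the noise step and `u` the cube root of `T f`, self-adjointness gives `𝔼[u⁴] =
𝔼[u · T f] = 𝔼[T u · f]`. Young's inequality and the `L⁴` contraction of `T u` then absorb a quarter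
of `𝔼[u⁴]`. -/
theorem expect_cubeRoot_noiseStep_le (X : PartiteComplex Ω) (i : Fin d) {t : ℝ}
    (ht : |t| ≤ 1 / 4) (f : (∀ i, Ω i) → ℝ) :
    (X.expect fun x => cubeRoot (X.noiseStep i t f x) ^ 4) ≤ X.expect fun x => cubeRoot (f x) ^ 4 := by
  set u : (∀ i, Ω i) → ℝ := fun x => cubeRoot (X.noiseStep i t f x) with hu
  have e : (X.expect fun x => u x ^ 4) = X.expect fun x => X.noiseStep i t u x * f x := by
    rw [← expect_mul_noiseStep]
    refine X.expect_congr fun x _ => ?_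
    rw [← cubeRoot_pow_three (X.noiseStep i t f x)]
    change u x ^ 4 = u x * u x ^ 3
    ring
  have h1 : (X.expect fun x => X.noiseStep i t u x * f x) ≤ X.expect fun x =>
      1 / 4 * X.noiseStep i t u x ^ 4 + 3 / 4 * cubeRoot (f x) ^ 4 := X.expect_mono fun x _ => by
    nth_rw 1 [← cubeRoot_pow_three (f x)]
    set a := X.noiseStep i t u x
    set v := cubeRoot (f x)
    nlinarith [mul_nonneg (sq_nonneg (a - v)) (add_nonneg (sq_nonneg (a + v)) (sq_nonneg v)),
      mul_nonneg (sq_nonneg (a - v)) (sq_nonneg v)]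
  rw [expect_add, expect_const_mul, expect_const_mul] at h1
  have h2 := X.expect_noiseStep_pow_four_le i ht u
  change (X.expect fun x => u x ^ 4) ≤ _
  linarith

theorem expect_noise_pow_four_le (X : PartiteComplex Ω) {s : Fin d → ℝ} (hs : ∀ i, |s i| ≤ 1 / 4)
    (l : List (Fin d)) (f : (∀ i, Ω i) → ℝ) :
    (X.expect fun x => X.noise s l f x ^ 4) ≤ X.expect fun x => f x ^ 4 := by
  induction l generalizing f with
  | nil => rfl
  | cons i l ih => exact (ih _).trans (X.expect_noiseStep_pow_four_le i (hs i) f)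

theorem expect_cubeRoot_noise_le (X : PartiteComplex Ω) {s : Fin d → ℝ} (hs : ∀ i, |s i| ≤ 1 / 4)
    (l : List (Fin d)) (f : (∀ i, Ω i) → ℝ) :
    (X.expect fun x => cubeRoot (X.noise s l f x) ^ 4) ≤ X.expect fun x => cubeRoot (f x) ^ 4 := by
  induction l generalizing f with
  | nil => rfl
  | cons i l ih => exact (ih _).trans (X.expect_cubeRoot_noiseStep_le i (hs i) f)

/-! ### Comparison with the inclusion–exclusion decomposition -/

/-- `∑_{T ⊆ S} (-1)^{|S ∖ T|} E_{T ∪ R}`. -/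
def efron (X : PartiteComplex Ω) (R S : Finset (Fin d)) :
    ((∀ i, Ω i) → ℝ) →ₗ[ℝ] ((∀ i, Ω i) → ℝ) :=
  ∑ T ∈ S.powerset, (-1 : ℝ) ^ (S.card + T.card) • X.avg (T ∪ R)

theorem efron_apply (X : PartiteComplex Ω) (R S : Finset (Fin d)) (f : (∀ i, Ω i) → ℝ) :
    X.efron R S f = ∑ T ∈ S.powerset, (-1 : ℝ) ^ (S.card + T.card) • X.avg (T ∪ R) f := by
  simp [efron, LinearMap.sum_apply]

/-- The subsets split according to whether they contain `i`, mirroring `L_i = id - E_{[d] ∖ {i}}`;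
this drives the comparison with `piece`. -/
theorem efron_insert (X : PartiteComplex Ω) (R : Finset (Fin d)) {S : Finset (Fin d)} {i : Fin d}
    (hi : i ∉ S) : X.efron R (insert i S) = X.efron (insert i R) S - X.efron R S := by
  unfold efron
  rw [Finset.sum_powerset_insert hi, Finset.card_insert_of_notMem hi, add_comm, sub_eq_add_neg,
    ← Finset.sum_neg_distrib]
  congr 1 <;> refine Finset.sum_congr rfl fun T hT => ?_
  · rw [Finset.card_insert_of_notMem fun h => hi (Finset.mem_powerset.1 hT h),
      Finset.insert_union, Finset.union_insert]
    congr 1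
    ring
  · refine LinearMap.ext fun f => funext fun x => ?_
    change (-1 : ℝ) ^ (S.card + 1 + T.card) * X.avg (T ∪ R) f x
      = -((-1 : ℝ) ^ (S.card + T.card) * X.avg (T ∪ R) f x)
    ring

theorem norm2_sub_comm (X : PartiteComplex Ω) (f g : (∀ i, Ω i) → ℝ) :
    X.norm2 (f - g) = X.norm2 (g - f) := by
  rw [← neg_sub g f, ← neg_one_smul ℝ (g - f), norm2_smul]
  simp

theorem norm2_lap_le (X : PartiteComplex Ω) (i : Fin d) (f : (∀ i, Ω i) → ℝ) :
    X.norm2 (X.lap i f) ≤ X.norm2 f := by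
  refine X.norm2_le_of_sq_le (X.norm2_nonneg f) ?_
  rw [norm2_sq, ← X.expect_avg_sq_add_lap_sq i f]
  exact le_add_of_nonneg_left (X.expect_nonneg fun _ _ => sq_nonneg _)

section GammaProduct

variable {X : PartiteComplex Ω} {γ : ℝ}

theorem IsGammaProduct.norm2_efron_avg_sub_efron_le (hX : X.IsGammaProduct γ) (hγ : 0 ≤ γ)
    {R S : Finset (Fin d)} {i : Fin d} (hR : i ∉ R) (hS : i ∉ S) (f : (∀ i, Ω i) → ℝ) :
    X.norm2 (X.efron (insert i R) S (X.avg (Finset.univ.erase i) f) - X.efron R S f)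
      ≤ 2 ^ d * (d * γ) * X.norm2 f := by
  rw [efron_apply, efron_apply, ← Finset.sum_sub_distrib]
  refine (X.norm2_sum_le _ _).trans ?_
  have h : ∀ T ∈ S.powerset, X.norm2 ((-1 : ℝ) ^ (S.card + T.card)
        • X.avg (T ∪ insert i R) (X.avg (Finset.univ.erase i) f)
      - (-1 : ℝ) ^ (S.card + T.card) • X.avg (T ∪ R) f) ≤ (d * γ) * X.norm2 f := fun T hT => by
    rw [← smul_sub, norm2_smul, abs_pow, abs_neg, abs_one, one_pow, one_mul, Finset.union_insert]
    refine hX.norm2_avg_insert_avg_sub_avg_le hγ f ?_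
    rw [Finset.mem_union, not_or]
    exact ⟨fun h => hS (Finset.mem_powerset.1 hT h), hR⟩
  refine (Finset.sum_le_card_nsmul _ _ _ h).trans ?_
  rw [Finset.card_powerset, nsmul_eq_mul, mul_assoc (2 ^ d)]
  have hn := mul_nonneg (mul_nonneg (Nat.cast_nonneg d) hγ) (X.norm2_nonneg f)
  refine mul_le_mul_of_nonneg_right ?_ hn
  push_cast
  exact pow_le_pow_right₀ one_le_two ((Finset.card_le_univ S).trans_eq (Fintype.card_fin d))

/-- Induction on the list, where `R` holds the coordinates already processed. Processing `i`
exchanges `efron (insert i R)` after `E_{[d] ∖ {i}}` for `efron R`, at the price of one commutation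
error. For the empty list both sides are the identity on faces. -/
theorem IsGammaProduct.norm2_piece_sub_efron_le (hX : X.IsGammaProduct γ) (hγ : 0 ≤ γ)
    {l : List (Fin d)} (hl : l.Nodup) {R S : Finset (Fin d)} (hR : ∀ i, i ∈ R ↔ i ∉ l)
    (hS : ∀ i ∈ S, i ∈ l) (f : (∀ i, Ω i) → ℝ) :
    X.norm2 (X.piece S l f - X.efron R S f) ≤ l.length * (2 ^ d * (d * γ)) * X.norm2 f := by
  have hδ : 0 ≤ 2 ^ d * (d * γ) := by positivity
  induction l generalizing R S f with
  | nil =>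
    obtain rfl : S = ∅ := Finset.eq_empty_of_forall_notMem fun i hi => by simpa using hS i hi
    obtain rfl : R = Finset.univ := Finset.eq_univ_of_forall fun i => (hR i).2 (by simp)
    rw [X.norm2_congr (g := 0), norm2_zero]
    · simp
    · intro x hx
      simp [piece, efron_apply, avg_apply, X.condExpect_univ f hx]
  | cons i l ih =>
    rw [List.nodup_cons] at hl
    have hiR : i ∉ R := fun h => (hR i).1 h List.mem_cons_self
    have hR' : ∀ j, j ∈ insert i R ↔ j ∉ l := fun j => by
      rw [Finset.mem_insert, hR, List.mem_cons, not_or]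
      constructor
      · rintro (rfl | h)
        exacts [hl.1, h.2]
      · intro h
        by_cases hj : j = i
        exacts [.inl hj, .inr ⟨hj, h⟩]
    have main : ∀ S' : Finset (Fin d), i ∉ S' →
        X.norm2 (X.efron (insert i R) S' (X.avg (Finset.univ.erase i) f) - X.efron R S' f)
          ≤ 2 ^ d * (d * γ) * X.norm2 f :=
      fun S' hS' => hX.norm2_efron_avg_sub_efron_le hγ hiR hS' f
    rw [List.length_cons]
    push_cast
    by_cases hi : i ∈ S
    · obtain ⟨S', hiS', rfl⟩ : ∃ S', i ∉ S' ∧ S = insert i S' :=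
        ⟨S.erase i, Finset.notMem_erase i S, (Finset.insert_erase hi).symm⟩
      have hS' : ∀ j ∈ S', j ∈ l := fun j hj =>
        (List.mem_cons.1 (hS j (Finset.mem_insert_of_mem hj))).resolve_left fun h => hiS' (h ▸ hj)
      rw [X.piece_cons_of_mem hi, X.piece_insert_of_notMem S' hl.1, X.efron_insert R hiS',
        LinearMap.sub_apply]
      have h1 := ih hl.2 hR' hS' (X.lap i f)
      have h2 := main S' hiS'
      have e : X.piece S' l (X.lap i f) - (X.efron (insert i R) S' f - X.efron R S' f)
          = (X.piece S' l (X.lap i f) - X.efron (insert i R) S' (X.lap i f))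
            + (X.efron R S' f - X.efron (insert i R) S' (X.avg (Finset.univ.erase i) f)) := by
        rw [lap_eq, map_sub (X.efron (insert i R) S')]
        abel
      rw [e]
      refine (X.norm2_add_le _ _).trans ?_
      rw [X.norm2_sub_comm (X.efron R S' f)]
      have h3 := mul_le_mul_of_nonneg_left (X.norm2_lap_le i f)
        (mul_nonneg (Nat.cast_nonneg l.length) hδ)
      linarith
    · have hS' : ∀ j ∈ S, j ∈ l := fun j hj =>
        (List.mem_cons.1 (hS j hj)).resolve_left fun h => hi (h ▸ hj)
      rw [X.piece_cons_of_notMem hi]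
      have h1 := ih hl.2 hR' hS' (X.avg (Finset.univ.erase i) f)
      have h2 := main S hi
      rw [← sub_add_sub_cancel _ (X.efron (insert i R) S (X.avg (Finset.univ.erase i) f))]
      refine (X.norm2_add_le _ _).trans ?_
      have h3 := mul_le_mul_of_nonneg_left (X.norm2_avg_le (Finset.univ.erase i) f)
        (mul_nonneg (Nat.cast_nonneg l.length) hδ)
      linarith

end GammaProduct

/-- The component of level `S` of the ordered Efron–Stein decomposition. -/
def component (X : PartiteComplex Ω) (S : Finset (Fin d)) :
    ((∀ i, Ω i) → ℝ) →ₗ[ℝ] ((∀ i, Ω i) → ℝ) := X.piece S Finset.univ.toList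

theorem sum_expect_component_sq (X : PartiteComplex Ω) (f : (∀ i, Ω i) → ℝ) :
    ∑ S, (X.expect fun x => X.component S f x ^ 2) = X.expect fun x => f x ^ 2 := by
  have h := X.sum_expect_piece_sq (Finset.nodup_toList Finset.univ) f
  rwa [Finset.toList_toFinset, Finset.powerset_univ] at h

theorem IsGammaProduct.norm2_component_sub_efron_le {X : PartiteComplex Ω} {γ : ℝ}
    (hX : X.IsGammaProduct γ) (hγ : 0 ≤ γ) (S : Finset (Fin d)) (f : (∀ i, Ω i) → ℝ) :
    X.norm2 (X.component S f - X.efron ∅ S f) ≤ d * (2 ^ d * (d * γ)) * X.norm2 f := by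
  have h := hX.norm2_piece_sub_efron_le hγ (Finset.nodup_toList Finset.univ) (R := ∅) (S := S)
    (by simp) (by simp) f
  rwa [Finset.length_toList, Finset.card_univ, Fintype.card_fin] at h

/-- The difference is `component S` applied to `g = E_{[d] ∖ {i}} f`. In the inclusion–exclusion
form the terms with and without `i` nearly cancel: those without `i` do not distinguish `g` from
`f`, and those with `i` reduce to them by approximate commutation. -/
theorem IsGammaProduct.norm2_component_sub_component_lap_le {X : PartiteComplex Ω} {γ : ℝ}
    (hX : X.IsGammaProduct γ) (hγ : 0 ≤ γ) {S : Finset (Fin d)} {i : Fin d} (hi : i ∈ S)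
    (f : (∀ i, Ω i) → ℝ) :
    X.norm2 (X.component S f - X.component S (X.lap i f))
      ≤ (d + 1) * (2 ^ d * (d * γ)) * X.norm2 f := by
  set g := X.avg (Finset.univ.erase i) f with hg
  have e : X.component S f - X.component S (X.lap i f) = (X.component S g - X.efron ∅ S g)
      + X.efron ∅ S g := by
    rw [lap_eq, map_sub, ← hg]
    abel
  have h1 := hX.norm2_component_sub_efron_le hγ S g
  have h2 : X.norm2 (X.efron ∅ S g) ≤ 2 ^ d * (d * γ) * X.norm2 f := by
    obtain ⟨S', hiS', rfl⟩ : ∃ S', i ∉ S' ∧ S = insert i S' :=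
      ⟨S.erase i, Finset.notMem_erase i S, (Finset.insert_erase hi).symm⟩
    rw [X.efron_insert ∅ hiS', LinearMap.sub_apply]
    have h3 : X.efron ∅ S' g = X.efron ∅ S' f := by
      rw [efron_apply, efron_apply]
      refine Finset.sum_congr rfl fun T hT => ?_
      rw [hg, X.avg_avg_of_subset fun k hk => ?_]
      rw [Finset.union_empty] at hk
      exact Finset.mem_erase.2
        ⟨fun h => hiS' (h ▸ Finset.mem_powerset.1 hT hk), Finset.mem_univ k⟩
    rw [h3]
    exact hX.norm2_efron_avg_sub_efron_le hγ (Finset.notMem_empty i) hiS' f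
  rw [e]
  refine (X.norm2_add_le _ _).trans ?_
  have h4 := mul_le_mul_of_nonneg_left (X.norm2_avg_le (Finset.univ.erase i) f)
    (show 0 ≤ d * (2 ^ d * (d * γ)) by positivity)
  rw [← hg] at h4
  linarith

/-- The signs sum to zero over the subsets of a nonempty set, so `𝔼[f]` can be subtracted from each
of the `2^|S|` terms. -/
theorem abs_efron_empty_le (X : PartiteComplex Ω) {S : Finset (Fin d)} (hS : S.Nonempty)
    (f : (∀ i, Ω i) → ℝ) (x : ∀ i, Ω i) {τ : ℝ}
    (h : ∀ T ⊆ S, |X.condExpect T f x - X.expect f| ≤ τ) :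
    |X.efron ∅ S f x| ≤ 2 ^ S.card * τ := by
  have h0 : ∑ T ∈ S.powerset, (-1 : ℝ) ^ (S.card + T.card) = 0 := by
    simp only [pow_add, ← Finset.mul_sum]
    have := Finset.sum_powerset_neg_one_pow_card_of_nonempty hS
    rw [show ∑ T ∈ S.powerset, (-1 : ℝ) ^ T.card = 0 by exact_mod_cast this, mul_zero]
  have e : X.efron ∅ S f x = ∑ T ∈ S.powerset,
      (-1 : ℝ) ^ (S.card + T.card) * (X.condExpect T f x - X.expect f) := by
    simp only [mul_sub, Finset.sum_sub_distrib, ← Finset.sum_mul, h0, zero_mul, sub_zero]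
    simp [efron_apply, Finset.sum_apply, avg_apply]
  rw [e]
  refine (Finset.abs_sum_le_sum_abs _ _).trans ?_
  refine (Finset.sum_le_card_nsmul _ _ τ fun T hT => ?_).trans_eq ?_
  · rw [abs_mul, abs_pow, abs_neg, abs_one, one_pow, one_mul]
    exact h T (Finset.mem_powerset.1 hT)
  · rw [Finset.card_powerset, nsmul_eq_mul]
    push_cast
    rfl

/-! ### Consequences of hypercontractivity -/

/-- The bridge between the complex and the cube: at a fixed `x`, randomized noise is a polynomial in
independent signs, whatever the complex. -/
theorem noise_sign_eq_walsh (X : PartiteComplex Ω) (f : (∀ i, Ω i) → ℝ) (x : ∀ i, Ω i)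
    (r : Fin d → Bool) :
    X.noise (fun i => SignCube.sign (r i) * (1 / 4)) Finset.univ.toList f x
      = SignCube.walsh Finset.univ (fun S => (1 / 4) ^ S.card * X.component S f x) r := by
  rw [X.noise_eq_sum_piece _ (Finset.nodup_toList Finset.univ), Finset.toList_toFinset,
    Finset.sum_apply, SignCube.walsh]
  refine Finset.sum_congr rfl fun S _ => ?_
  rw [Pi.smul_apply, smul_eq_mul, Finset.prod_mul_distrib, Finset.prod_const, mul_assoc]
  rfl

theorem abs_sign_mul_quarter_le (b : Bool) : |SignCube.sign b * (1 / 4)| ≤ 1 / 4 := by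
  rw [abs_mul, SignCube.abs_sign]
  norm_num

theorem expect_mean (X : PartiteComplex Ω) (h : (Fin d → Bool) → (∀ i, Ω i) → ℝ) :
    (X.expect fun x => SignCube.mean fun r => h r x) = SignCube.mean fun r => X.expect (h r) := by
  simp only [SignCube.mean, div_eq_inv_mul]
  rw [expect_const_mul, expect_sum]

/-- If the low-degree weight of a randomization is pointwise small, it is controlled by the
`4/3`-norm. -/
theorem expect_small_weight_le (X : PartiteComplex Ω) (g : (∀ i, Ω i) → ℝ) (k : ℕ)
    (p : Finset (Fin d) → Prop) [DecidablePred p] (hp : ∀ S, p S → S.card ≤ k)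
    {η : ℝ} (hη : 0 < η) {A : (∀ i, Ω i) → ℝ}
    (hA : ∀ x, A x = ∑ S with p S, (1 / 16) ^ S.card * X.component S g x ^ 2)
    [DecidablePred fun x => A x < η ^ 3 / 9 ^ k] :
    (X.expect fun x => if A x < η ^ 3 / 9 ^ k then A x else 0)
      ≤ η * X.expect fun x => cubeRoot (g x) ^ 4 := by
  set V : (∀ i, Ω i) → ℝ := fun x => SignCube.mean fun r => cubeRoot
    (X.noise (fun i => SignCube.sign (r i) * (1 / 4)) Finset.univ.toList g x) ^ 4 with hV
  have hV0 : ∀ x, 0 ≤ V x := fun x => SignCube.mean_nonneg fun r => by positivity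
  have hEV : X.expect V ≤ X.expect fun x => cubeRoot (g x) ^ 4 := by
    rw [hV, expect_mean, ← SignCube.mean_const (ι := Fin d) (X.expect fun x => cubeRoot (g x) ^ 4)]
    exact SignCube.mean_mono fun r =>
      X.expect_cubeRoot_noise_le (fun i => abs_sign_mul_quarter_le (r i)) _ g
  have hAV : ∀ x, A x ^ 2 ≤ 9 ^ k * V x ^ 3 := fun x => by
    have h := SignCube.sum_sq_sq_le_of_walsh_eq_cube Finset.univ k
      (fun S => (1 / 4) ^ S.card * X.component S g x) p (fun S _ => hp S)
      (fun r => cubeRoot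
        (X.noise (fun i => SignCube.sign (r i) * (1 / 4)) Finset.univ.toList g x))
      (fun r => by rw [cubeRoot_pow_three, noise_sign_eq_walsh])
    refine le_trans (le_of_eq ?_) h
    rw [hA, Finset.powerset_univ]
    congr 1
    refine Finset.sum_congr rfl fun S _ => ?_
    rw [mul_pow, ← pow_mul, mul_comm S.card, pow_mul]
    norm_num
  refine (X.expect_mono (g := fun x => η * V x) fun x _ => ?_).trans ?_
  · split_ifs with h
    · have hA0 : 0 ≤ A x := by
        rw [hA]
        exact Finset.sum_nonneg fun S _ => by positivity
      refine le_of_pow_le_pow_left₀ three_ne_zero (mul_nonneg hη.le (hV0 x)) ?_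
      rw [lt_div_iff₀ (by positivity)] at h
      -- The threshold `η^3 / 9^k` is exactly what turns `A^2 ≤ 9^k V^3` into `A ≤ η V`.
      calc A x ^ 3 = A x * A x ^ 2 := by ring
        _ ≤ A x * (9 ^ k * V x ^ 3) := mul_le_mul_of_nonneg_left (hAV x) hA0
        _ = (A x * 9 ^ k) * V x ^ 3 := by ring
        _ ≤ η ^ 3 * V x ^ 3 := mul_le_mul_of_nonneg_right h.le (pow_nonneg (hV0 x) 3)
        _ = _ := by ring
    · exact mul_nonneg hη.le (hV0 x)
  · rw [expect_const_mul]
    exact mul_le_mul_of_nonneg_left hEV hη.le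

/-- At each `x` the squared second moment of the randomization is at most its fourth moment, which
on average is at most `𝔼[f⁴]` by contraction. Undoing the damping costs `16^k` before squaring. -/
theorem expect_low_weight_sq_le (X : PartiteComplex Ω) (f : (∀ i, Ω i) → ℝ) (k : ℕ) :
    (X.expect fun x => (∑ S with S.card ≤ k, X.component S f x ^ 2) ^ 2)
      ≤ 256 ^ k * X.expect fun x => f x ^ 4 := by
  have h1 : ∀ x, (∑ S with S.card ≤ k, X.component S f x ^ 2) ^ 2 ≤ 256 ^ k *
      SignCube.mean fun r =>
        X.noise (fun i => SignCube.sign (r i) * (1 / 4)) Finset.univ.toList f x ^ 4 := fun x => by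
    have h := SignCube.sum_sq_sq_le_mean_walsh_pow_four Finset.univ
      (fun S => (1 / 4) ^ S.card * X.component S f x)
    rw [Finset.powerset_univ] at h
    simp only [← noise_sign_eq_walsh] at h
    have h2 : ∑ S with S.card ≤ k, X.component S f x ^ 2
        ≤ 16 ^ k * ∑ S, ((1 / 4) ^ S.card * X.component S f x) ^ 2 := by
      rw [Finset.mul_sum]
      refine (Finset.sum_le_sum fun S hS => ?_).trans (Finset.sum_le_sum_of_subset_of_nonneg
        (Finset.filter_subset _ _) fun S _ _ => by positivity)
      have hk := (Finset.mem_filter.1 hS).2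
      rw [mul_pow, ← mul_assoc, ← pow_mul, mul_comm S.card, pow_mul]
      refine le_mul_of_one_le_left (sq_nonneg _) ?_
      calc (1 : ℝ) = 16 ^ S.card * ((1 / 4) ^ 2) ^ S.card := by rw [← mul_pow]; norm_num
        _ ≤ _ := by gcongr; norm_num
    calc _ ≤ (16 ^ k * ∑ S, ((1 / 4) ^ S.card * X.component S f x) ^ 2) ^ 2 := by gcongr
      _ = 256 ^ k * (∑ S, ((1 / 4) ^ S.card * X.component S f x) ^ 2) ^ 2 := by
        rw [mul_pow, ← pow_mul, mul_comm k, pow_mul]; norm_num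
      _ ≤ _ := by gcongr
  refine (X.expect_mono fun x _ => h1 x).trans ?_
  rw [expect_const_mul, expect_mean]
  refine mul_le_mul_of_nonneg_left ?_ (by positivity)
  rw [← SignCube.mean_const (ι := Fin d) (X.expect fun x => f x ^ 4)]
  exact SignCube.mean_mono fun r =>
    X.expect_noise_pow_four_le (fun i => abs_sign_mul_quarter_le (r i)) _ f

/-- Since `f` is `±1` and its averages lie in `[-1, 1]`, the Laplacian has the sign of `f` and `|L_i
f| = f · L_i f ≤ 2`. Hence its `4/3`-moment is controlled by the influence itself. -/
theorem expect_cubeRoot_lap_le (X : PartiteComplex Ω) {f : (∀ i, Ω i) → ℝ}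
    (hf : ∀ x, X.IsFace x → f x = 1 ∨ f x = -1) (i : Fin d) :
    (X.expect fun x => cubeRoot (X.lap i f x) ^ 4) ≤ 2 * X.expect fun x => f x * X.lap i f x := by
  rw [← expect_const_mul]
  refine X.expect_mono fun x hx => ?_
  have h1 := X.condExpect_mono (Finset.univ.erase i) (f := f) (g := fun _ => 1)
    (fun y hy => by rcases hf y hy with h | h <;> norm_num [h]) x
  have h2 := X.condExpect_mono (Finset.univ.erase i) (f := fun _ => -1) (g := f)
    (fun y hy => by rcases hf y hy with h | h <;> norm_num [h]) x
  rw [X.condExpect_const _ _ hx] at h1 h2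
  have e : |X.lap i f x| = f x * X.lap i f x := by
    rw [lap_apply, avg_apply]
    rcases hf x hx with h | h <;> rw [h]
    · rw [abs_of_nonneg (by linarith)]; ring
    · rw [abs_of_nonpos (by linarith)]; ring
  rw [← e]
  refine cubeRoot_pow_four_le ?_
  rw [lap_apply, avg_apply, abs_le]
  rcases hf x hx with h | h <;> rw [h] <;> constructor <;> linarith

/-- Weighting `S` by `M^(k - |S|) ≥ 1` bounds the count by `M^k (1 + 1/M)^|J| ≤ e M^k`. -/
theorem card_filter_subset_card_le {ι : Type*} [Fintype ι] [DecidableEq ι] (J : Finset ι)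
    {M : ℝ} (hM : 1 ≤ M) (hJ : (J.card : ℝ) ≤ M) (k : ℕ) :
    ((Finset.univ.filter fun S : Finset ι => S ⊆ J ∧ S.card ≤ k).card : ℝ) ≤ 3 * M ^ k := by
  have hM0 : 0 < M := by linarith
  have h1 : ((Finset.univ.filter fun S : Finset ι => S ⊆ J ∧ S.card ≤ k).card : ℝ)
      ≤ M ^ k * ∑ S ∈ J.powerset, (1 / M) ^ S.card * 1 ^ (J.card - S.card) := by
    rw [Finset.mul_sum, ← nsmul_one, ← Finset.sum_const]
    refine (Finset.sum_le_sum fun S hS => ?_).trans (Finset.sum_le_sum_of_subset_of_nonneg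
      (fun S hS => Finset.mem_powerset.2 (Finset.mem_filter.1 hS).2.1) fun S _ _ => by positivity)
    have hk := (Finset.mem_filter.1 hS).2.2
    rw [one_pow, mul_one]
    calc (1 : ℝ) = M ^ S.card * (1 / M) ^ S.card := by
          rw [← mul_pow, mul_one_div_cancel hM0.ne', one_pow]
      _ ≤ _ := by gcongr
  rw [Finset.sum_pow_mul_eq_add_pow] at h1
  have h2 : (1 / M + 1) ^ J.card ≤ 3 :=
    calc (1 / M + 1) ^ J.card ≤ Real.exp (1 / M) ^ J.card := by
          gcongr
          exact Real.add_one_le_exp _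
      _ = Real.exp (J.card * (1 / M)) := by rw [Real.exp_nat_mul]
      _ ≤ Real.exp 1 := by
          gcongr
          rw [mul_one_div]
          exact (div_le_one hM0).2 hJ
      _ ≤ 3 := Real.exp_one_lt_three.le
  calc _ ≤ _ := h1
    _ ≤ M ^ k * 3 := by gcongr
    _ = _ := mul_comm _ _

/-! ### Boosters -/

theorem variance_eq (X : PartiteComplex Ω) (f : (∀ i, Ω i) → ℝ) :
    X.variance f = (X.expect fun x => f x ^ 2) - X.expect f ^ 2 := by
  have e : X.variance f = X.expect fun x =>
      (f x ^ 2 + X.expect f ^ 2) - 2 * X.expect f * f x :=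
    X.expect_congr fun x _ => by ring
  rw [e, expect_sub, expect_add, expect_const, expect_const_mul]
  ring

theorem expect_pow_eq_one_of_sign (X : PartiteComplex Ω) {f : (∀ i, Ω i) → ℝ}
    (hf : ∀ x, X.IsFace x → f x = 1 ∨ f x = -1) {n : ℕ} (hn : Even n) :
    (X.expect fun x => f x ^ n) = 1 := by
  rw [X.expect_congr (g := fun _ => 1) fun x hx => ?_, expect_const]
  rcases hf x hx with h | h <;> rw [h]
  exacts [one_pow n, hn.neg_one_pow]

theorem norm2_eq_one_of_sign (X : PartiteComplex Ω) {f : (∀ i, Ω i) → ℝ}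
    (hf : ∀ x, X.IsFace x → f x = 1 ∨ f x = -1) : X.norm2 f = 1 := by
  rw [norm2, X.expect_pow_eq_one_of_sign hf even_two, Real.sqrt_one]

theorem expect_sq_le_two_mul_add (X : PartiteComplex Ω) {f g : (∀ i, Ω i) → ℝ} {β : ℝ}
    (h : X.norm2 (f - g) ≤ β) :
    (X.expect fun x => f x ^ 2) ≤ 2 * (X.expect fun x => g x ^ 2) + 2 * β ^ 2 := by
  have h1 := X.expect_sq_le_of_norm2_le h
  have h2 : (X.expect fun x => f x ^ 2) ≤
      X.expect fun x => 2 * g x ^ 2 + 2 * (f - g) x ^ 2 := X.expect_mono fun x _ => by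
    rw [Pi.sub_apply]
    nlinarith [sq_nonneg (f x - 2 * g x)]
  rw [expect_add, expect_const_mul, expect_const_mul] at h2
  linarith

section

variable {X : PartiteComplex Ω} {f : (∀ i, Ω i) → ℝ} {β : ℝ}

/-- By Parseval it suffices that `component ∅ f` is within `β` of the constant `𝔼[f]`. The loss is
`2β|𝔼[f]| + β^2 ≤ 3β`. -/
theorem variance_sub_le_sum_expect_component_sq (hf : ∀ x, X.IsFace x → f x = 1 ∨ f x = -1)
    (hβ0 : 0 ≤ β) (hβ1 : β ≤ 1) (hB : X.norm2 (X.component ∅ f - X.efron ∅ ∅ f) ≤ β) :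
    X.variance f - 3 * β ≤ ∑ S with S.Nonempty, X.expect fun x => X.component S f x ^ 2 := by
  have h1 := X.expect_pow_eq_one_of_sign hf even_two
  have hmean : |X.expect f| ≤ 1 := by
    have := X.expect_mul_sq_le f fun _ => 1
    simp only [mul_one, one_pow, expect_const, h1] at this
    exact (sq_le_one_iff_abs_le_one _).1 this
  have h2 : X.norm2 (X.component ∅ f) ≤ β + |X.expect f| := by
    have e : X.norm2 (X.efron ∅ ∅ f) = |X.expect f| := by
      rw [X.norm2_congr (g := X.expect f • fun _ => 1), norm2_smul, norm2]
      · simp [expect_const]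
      · intro x _
        simp [efron_apply, avg_apply, condExpect_empty]
    have := X.norm2_add_le (X.component ∅ f - X.efron ∅ ∅ f) (X.efron ∅ ∅ f)
    rw [sub_add_cancel] at this
    linarith
  have h3 := X.expect_sq_le_of_norm2_le h2
  have h4 := X.sum_expect_component_sq f
  rw [← Finset.sum_filter_add_sum_filter_not Finset.univ fun S : Finset (Fin d) => S.Nonempty] at h4
  have h5 : (Finset.univ.filter fun S : Finset (Fin d) => ¬S.Nonempty) = {∅} := by
    ext S; simp
  rw [h5, Finset.sum_singleton, h1] at h4
  rw [variance_eq, h1]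
  nlinarith [sq_abs (X.expect f), abs_nonneg (X.expect f)]

theorem totalInfluence_eq (X : PartiteComplex Ω) (f : (∀ i, Ω i) → ℝ) :
    X.totalInfluence f = ∑ i, X.expect fun x => f x * X.lap i f x := rfl

theorem sum_filter_two_mul_sq_le (β : ℝ) (p : Finset (Fin d) → Prop) [DecidablePred p] :
    ∑ _S : Finset (Fin d) with p _S, 2 * β ^ 2 ≤ 2 * (2 ^ d * β ^ 2) := by
  rw [Finset.sum_const, nsmul_eq_mul]
  have : ((Finset.univ.filter p).card : ℝ) ≤ 2 ^ d := by
    have := Finset.card_filter_le (Finset.univ : Finset (Finset (Fin d))) p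
    rw [Finset.card_univ, Fintype.card_finset, Fintype.card_fin] at this
    exact_mod_cast this
  nlinarith [sq_nonneg β]

/-- Double counting of pairs `i ∈ S`: for fixed `i`, replacing `f` by `L_i f` and applying Parseval
to `L_i f` yields the influence of `i`. -/
theorem sum_card_mul_expect_component_sq_le (hC : ∀ S, ∀ i ∈ S, X.norm2 (X.component S f - X.component S (X.lap i f)) ≤ β) :
    ∑ S : Finset (Fin d), (S.card : ℝ) * (X.expect fun x => X.component S f x ^ 2)
      ≤ 2 * X.totalInfluence f + 2 * (d * (2 ^ d * β ^ 2)) := by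
  have e : ∑ S : Finset (Fin d), (S.card : ℝ) * (X.expect fun x => X.component S f x ^ 2)
      = ∑ i, ∑ S with i ∈ S, X.expect fun x => X.component S f x ^ 2 := by
    simp only [Finset.sum_filter]
    rw [Finset.sum_comm]
    refine Finset.sum_congr rfl fun S _ => ?_
    rw [← Finset.sum_filter, Finset.filter_mem_eq_inter, Finset.univ_inter, Finset.sum_const,
      nsmul_eq_mul]
  have h : ∀ i, (∑ S with i ∈ S, X.expect fun x => X.component S f x ^ 2)
      ≤ 2 * (X.expect fun x => f x * X.lap i f x) + 2 * (2 ^ d * β ^ 2) := fun i => by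
    refine (Finset.sum_le_sum fun S hS =>
      X.expect_sq_le_two_mul_add (hC S i (Finset.mem_filter.1 hS).2)).trans ?_
    rw [Finset.sum_add_distrib, ← Finset.mul_sum, ← expect_lap_sq, ← X.sum_expect_component_sq]
    refine add_le_add (mul_le_mul_of_nonneg_left (Finset.sum_le_sum_of_subset_of_nonneg
      (Finset.filter_subset _ _) fun S _ _ => X.expect_nonneg fun _ _ => sq_nonneg _) zero_le_two)
      (sum_filter_two_mul_sq_le β _)
  rw [e]
  refine (Finset.sum_le_sum fun i _ => h i).trans_eq ?_
  rw [Finset.sum_add_distrib, ← Finset.mul_sum, ← totalInfluence_eq, Finset.sum_const,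
    Finset.card_univ, Fintype.card_fin, nsmul_eq_mul]
  ring

theorem sum_high_degree_le (k : ℕ) (hk : 0 < k) :
    (∑ S with ¬S.card ≤ k, X.expect fun x => X.component S f x ^ 2)
      ≤ (∑ S : Finset (Fin d), (S.card : ℝ) * (X.expect fun x => X.component S f x ^ 2)) / k := by
  have hk' : (0 : ℝ) < k := by exact_mod_cast hk
  rw [le_div_iff₀ hk', Finset.sum_mul]
  have h0 : ∀ S, 0 ≤ X.expect fun x => X.component S f x ^ 2 := fun S =>
    X.expect_nonneg fun _ _ => sq_nonneg _
  refine (Finset.sum_le_sum fun S hS => ?_).trans (Finset.sum_le_sum_of_subset_of_nonneg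
    (Finset.filter_subset _ _) fun S _ _ => mul_nonneg (Nat.cast_nonneg _) (h0 S))
  have : k ≤ S.card := by
    have := (Finset.mem_filter.1 hS).2
    omega
  rw [mul_comm]
  exact mul_le_mul_of_nonneg_right (by exact_mod_cast this) (h0 S)

/-- The damped low-degree influence of coordinate `i` on the randomization of `f` at `x`. -/
def localInfluence (X : PartiteComplex Ω) (f : (∀ i, Ω i) → ℝ) (k : ℕ) (i : Fin d)
    (x : ∀ i, Ω i) : ℝ :=
  ∑ S with i ∈ S ∧ S.card ≤ k, (1 / 16) ^ S.card * X.component S (X.lap i f) x ^ 2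

theorem localInfluence_nonneg (k : ℕ) (i : Fin d) (x : ∀ i, Ω i) :
    0 ≤ X.localInfluence f k i x :=
  Finset.sum_nonneg fun S _ => by positivity

theorem expect_localInfluence_le (k : ℕ) (i : Fin d) :
    X.expect (X.localInfluence f k i) ≤ X.expect fun x => f x * X.lap i f x := by
  rw [← expect_lap_sq, ← X.sum_expect_component_sq, ← expect_sum]
  refine X.expect_mono fun x _ => ?_
  refine (Finset.sum_le_sum fun S _ => ?_).trans (Finset.sum_le_sum_of_subset_of_nonneg
    (Finset.filter_subset _ _) fun S _ _ => sq_nonneg _)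
  exact mul_le_of_le_one_left (sq_nonneg _) (pow_le_one₀ (by norm_num) (by norm_num))

open Classical in
/-- The coordinates whose damped low-degree influence at `x` is at least `θ`. -/
def notable (X : PartiteComplex Ω) (f : (∀ i, Ω i) → ℝ) (k : ℕ) (θ : ℝ) (x : ∀ i, Ω i) :
    Finset (Fin d) :=
  Finset.univ.filter fun i => θ ≤ X.localInfluence f k i x

theorem mem_notable {k : ℕ} {θ : ℝ} {x : ∀ i, Ω i} {i : Fin d} :
    i ∈ X.notable f k θ x ↔ θ ≤ X.localInfluence f k i x := by
  simp [notable]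

theorem expect_card_notable_le (k : ℕ) {θ : ℝ} (hθ : 0 < θ) :
    (X.expect fun x => ((X.notable f k θ x).card : ℝ)) ≤ X.totalInfluence f / θ := by
  rw [totalInfluence_eq, le_div_iff₀ hθ, mul_comm, ← expect_const_mul]
  refine le_trans (X.expect_mono (g := fun x => ∑ i, X.localInfluence f k i x) fun x _ => ?_) ?_
  · rw [mul_comm, ← nsmul_eq_mul, ← Finset.sum_const]
    exact (Finset.sum_le_sum fun i hi => mem_notable.1 hi).trans
      (Finset.sum_le_sum_of_subset_of_nonneg (Finset.subset_univ _) fun i _ _ =>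
        localInfluence_nonneg k i x)
  · rw [expect_sum]
    exact Finset.sum_le_sum fun i _ => expect_localInfluence_le k i

/-- This is where hypercontractivity gains the factor `η`. For each `i`, the part of the local
influence below the threshold has mean at most `η` times the `4/3`-moment of `L_i f`, hence at most
`2η` times the influence of `i`. The factor `16^k` undoes the damping, and `β` pays for replacing
`L_i f` by `f`. -/
theorem sum_expect_not_notable_le (hf : ∀ x, X.IsFace x → f x = 1 ∨ f x = -1) (hC : ∀ S, ∀ i ∈ S, X.norm2 (X.component S f - X.component S (X.lap i f)) ≤ β)
    (k : ℕ) {η : ℝ} (hη : 0 < η) :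
    (X.expect fun x => ∑ i, ∑ S with i ∈ S ∧ S.card ≤ k,
        if i ∈ X.notable f k (η ^ 3 / 9 ^ k) x then 0 else X.component S f x ^ 2)
      ≤ 4 * 16 ^ k * η * X.totalInfluence f + 2 * (d * (2 ^ d * β ^ 2)) := by
  classical
  have h : ∀ i, (X.expect fun x => ∑ S with i ∈ S ∧ S.card ≤ k,
        if i ∈ X.notable f k (η ^ 3 / 9 ^ k) x then 0 else X.component S f x ^ 2)
      ≤ 4 * 16 ^ k * η * (X.expect fun x => f x * X.lap i f x) + 2 * (2 ^ d * β ^ 2) := fun i => by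
    have h1 : ∀ x, (∑ S with i ∈ S ∧ S.card ≤ k,
        if i ∈ X.notable f k (η ^ 3 / 9 ^ k) x then 0 else X.component S f x ^ 2)
        ≤ 2 * 16 ^ k * (if X.localInfluence f k i x < η ^ 3 / 9 ^ k
            then X.localInfluence f k i x else 0)
          + ∑ S with i ∈ S ∧ S.card ≤ k,
              2 * (X.component S f - X.component S (X.lap i f)) x ^ 2 := fun x => by
      by_cases hx : X.localInfluence f k i x < η ^ 3 / 9 ^ k
      · rw [if_pos hx, localInfluence, Finset.mul_sum, ← Finset.sum_add_distrib]
        refine Finset.sum_le_sum fun S hS => ?_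
        rw [if_neg (mem_notable.not.2 (not_le.2 hx)), Pi.sub_apply]
        have hk := (Finset.mem_filter.1 hS).2.2
        have h16 : (1 : ℝ) ≤ 16 ^ k * (1 / 16) ^ S.card :=
          calc (1 : ℝ) = 16 ^ S.card * (1 / 16) ^ S.card := by rw [← mul_pow]; norm_num
            _ ≤ _ := by gcongr; norm_num
        have := mul_le_mul_of_nonneg_right h16 (sq_nonneg (X.component S (X.lap i f) x))
        nlinarith [sq_nonneg (X.component S f x - 2 * X.component S (X.lap i f) x)]
      · rw [if_neg hx, mul_zero, zero_add]
        refine Finset.sum_le_sum fun S _ => ?_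
        rw [if_pos (mem_notable.2 (not_lt.1 hx))]
        positivity
    refine (X.expect_mono fun x _ => h1 x).trans ?_
    rw [expect_add, expect_const_mul, expect_sum]
    have h2 := X.expect_small_weight_le (X.lap i f) k (fun S => i ∈ S ∧ S.card ≤ k)
      (fun S hS => hS.2) hη (A := X.localInfluence f k i) fun x => rfl
    have h3 := X.expect_cubeRoot_lap_le hf i
    have h4 := mul_le_mul_of_nonneg_left (h2.trans (mul_le_mul_of_nonneg_left h3 hη.le))
      (show (0 : ℝ) ≤ 2 * 16 ^ k by positivity)
    have h5 : (∑ S with i ∈ S ∧ S.card ≤ k, X.expect fun x =>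
        2 * (X.component S f - X.component S (X.lap i f)) x ^ 2) ≤ 2 * (2 ^ d * β ^ 2) := by
      refine (Finset.sum_le_sum fun S hS => ?_).trans (sum_filter_two_mul_sq_le β _)
      rw [expect_const_mul]
      exact mul_le_mul_of_nonneg_left
        (X.expect_sq_le_of_norm2_le (hC S i (Finset.mem_filter.1 hS).2.1)) zero_le_two
    linarith
  rw [expect_sum]
  refine (Finset.sum_le_sum fun i _ => h i).trans_eq ?_
  rw [Finset.sum_add_distrib, ← Finset.mul_sum, ← totalInfluence_eq, Finset.sum_const,
    Finset.card_univ, Fintype.card_fin, nsmul_eq_mul]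
  ring

open Classical in
theorem expect_indicator_low_weight_sq_le (hf : ∀ x, X.IsFace x → f x = 1 ∨ f x = -1) (k : ℕ)
    (p : (∀ i, Ω i) → Prop) :
    (X.expect fun x => if p x then ∑ S with S.card ≤ k, X.component S f x ^ 2 else 0) ^ 2
      ≤ X.prob p * 256 ^ k := by
  have h := X.expect_mul_sq_le (fun x => if p x then 1 else 0)
    fun x => ∑ S with S.card ≤ k, X.component S f x ^ 2
  have h4 := X.expect_low_weight_sq_le f k
  rw [X.expect_pow_eq_one_of_sign hf ⟨2, rfl⟩, mul_one] at h4
  simp only [ite_mul, one_mul, zero_mul, ite_pow, one_pow, zero_pow two_ne_zero] at h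
  rw [← prob_eq_expect] at h
  refine h.trans (mul_le_mul_of_nonneg_left h4 ?_)
  rw [prob_eq_expect]
  exact X.expect_nonneg fun x _ => by split_ifs <;> norm_num

theorem prob_or_card_notable_le (k : ℕ) {θ M : ℝ} (hθ : 0 < θ) (hM : 0 < M)
    (p : (∀ i, Ω i) → Prop) :
    X.prob (fun x => p x ∨ M < (X.notable f k θ x).card)
      ≤ X.prob p + X.totalInfluence f / θ / M := by
  classical
  have h := div_le_div_of_nonneg_right (expect_card_notable_le (X := X) (f := f) k hθ) hM.le
  refine le_trans ?_ (add_le_add_right h _)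
  rw [prob_eq_expect, prob_eq_expect, div_eq_inv_mul, ← expect_const_mul, ← expect_add]
  refine X.expect_mono fun x _ => ?_
  have hc : 0 ≤ M⁻¹ * ((X.notable f k θ x).card : ℝ) := by positivity
  by_cases h1 : p x
  · simp [h1, hc]
  · by_cases h2 : M < (X.notable f k θ x).card
    · simp only [h1, h2, or_true, if_true, if_false, zero_add]
      rw [← div_eq_inv_mul, le_div_iff₀ hM]
      linarith
    · simpa [h1, h2] using hc

/-- If few faces have boosters of size at most `k`, the variance of `f` is small. -/
theorem variance_le_of_prob_booster_le (hf : ∀ x, X.IsFace x → f x = 1 ∨ f x = -1)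
    (hβ0 : 0 ≤ β) (hβ1 : β ≤ 1)
    (hB : ∀ S, X.norm2 (X.component S f - X.efron ∅ S f) ≤ β)
    (hC : ∀ S, ∀ i ∈ S, X.norm2 (X.component S f - X.component S (X.lap i f)) ≤ β)
    {k : ℕ} (hk : 0 < k) {η τ M R : ℝ} (hη : 0 < η) (hτ : 0 ≤ τ) (hM : 1 ≤ M) (hR : 0 ≤ R)
    (hprob : (X.prob (fun x => ∃ T : Finset (Fin d), T.card ≤ k ∧ X.IsBooster f τ T x)
      + X.totalInfluence f / (η ^ 3 / 9 ^ k) / M) * 256 ^ k ≤ R ^ 2) :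
    X.variance f ≤ 3 * β + (2 * X.totalInfluence f + 2 * (d * (2 ^ d * β ^ 2))) / k
      + (4 * 16 ^ k * η * X.totalInfluence f + 2 * (d * (2 ^ d * β ^ 2))) + R
      + (6 * M ^ k * (2 ^ k * τ) ^ 2 + 2 * (2 ^ d * β ^ 2)) := by
  classical
  set θ := η ^ 3 / 9 ^ k with hθdef
  have hθ : 0 < θ := by positivity
  set bad : (∀ i, Ω i) → Prop :=
    fun x => ∃ T : Finset (Fin d), T.card ≤ k ∧ X.IsBooster f τ T x with hbad
  set exc : (∀ i, Ω i) → Prop := fun x => bad x ∨ M < (X.notable f k θ x).card with hexc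
  set t₁ : (∀ i, Ω i) → ℝ := fun x => ∑ i, ∑ S with i ∈ S ∧ S.card ≤ k,
    if i ∈ X.notable f k θ x then 0 else X.component S f x ^ 2 with ht₁
  set t₂ : (∀ i, Ω i) → ℝ := fun x =>
    if exc x then ∑ S with S.card ≤ k, X.component S f x ^ 2 else 0 with ht₂
  set t₃ : (∀ i, Ω i) → ℝ := fun x => 6 * M ^ k * (2 ^ k * τ) ^ 2
    + ∑ S : Finset (Fin d), 2 * (X.component S f - X.efron ∅ S f) x ^ 2 with ht₃
  have h1 := variance_sub_le_sum_expect_component_sq hf hβ0 hβ1 (hB ∅)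
  have h2 := (sum_high_degree_le (X := X) (f := f) k hk).trans
    (div_le_div_of_nonneg_right (sum_card_mul_expect_component_sq_le hC) (Nat.cast_nonneg k))
  have h3 : (∑ S with S.Nonempty, X.expect fun x => X.component S f x ^ 2)
      ≤ (∑ S with S.Nonempty ∧ S.card ≤ k, X.expect fun x => X.component S f x ^ 2)
        + ∑ S with ¬S.card ≤ k, X.expect fun x => X.component S f x ^ 2 := by
    have h0 : ∀ S, 0 ≤ X.expect fun x => X.component S f x ^ 2 := fun S =>
      X.expect_nonneg fun _ _ => sq_nonneg _
    simp only [Finset.sum_filter]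
    rw [← Finset.sum_add_distrib]
    refine Finset.sum_le_sum fun S _ => ?_
    by_cases hn : S.Nonempty <;> by_cases hc : S.card ≤ k <;> simp [hn, hc, h0 S]
  -- At an exceptional `x` everything is charged to `t₂`. Otherwise a set with a non-notable
  -- coordinate is charged to `t₁`, and a set of notable coordinates to `t₃`, where the absence of
  -- boosters bounds its inclusion–exclusion sum.
  have hpt : ∀ x, X.IsFace x → (∑ S with S.Nonempty ∧ S.card ≤ k, X.component S f x ^ 2)
      ≤ t₁ x + t₂ x + t₃ x := fun x _ => by
    have ht₁0 : 0 ≤ t₁ x := Finset.sum_nonneg fun i _ => Finset.sum_nonneg fun S _ => by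
      split_ifs
      exacts [le_rfl, sq_nonneg _]
    have ht₃0 : 0 ≤ t₃ x := add_nonneg (by positivity)
      (Finset.sum_nonneg fun S _ => by positivity)
    by_cases hx : exc x
    · have : (∑ S with S.Nonempty ∧ S.card ≤ k, X.component S f x ^ 2) ≤ t₂ x := by
        simp only [ht₂, if_pos hx]
        refine Finset.sum_le_sum_of_subset_of_nonneg (fun S hS => ?_) fun S _ _ => sq_nonneg _
        simp only [Finset.mem_filter] at hS ⊢
        exact ⟨hS.1, hS.2.2⟩
      linarith
    · have ht₂0 : t₂ x = 0 := by simp only [ht₂, if_neg hx]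
      rw [ht₂0, add_zero]
      rw [hexc, not_or] at hx
      set J := X.notable f k θ x with hJ
      have hJM : (J.card : ℝ) ≤ M := not_lt.1 hx.2
      have hsmall : ∀ S : Finset (Fin d), S.Nonempty → S.card ≤ k →
          X.efron ∅ S f x ^ 2 ≤ (2 ^ k * τ) ^ 2 := fun S hS hSk => by
        have := X.abs_efron_empty_le hS f x (τ := τ) fun T hT => by
          by_contra hlt
          exact hx.1 ⟨T, (Finset.card_le_card hT).trans hSk, (not_le.1 hlt).le⟩
        rw [← sq_abs (X.efron ∅ S f x)]
        refine pow_le_pow_left₀ (abs_nonneg _) (this.trans ?_) 2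
        gcongr
        norm_num
      have e₁ : t₁ x = ∑ S with S.card ≤ k, ∑ i ∈ S,
          if i ∈ J then 0 else X.component S f x ^ 2 := by
        simp only [ht₁, Finset.sum_filter]
        rw [Finset.sum_comm]
        refine Finset.sum_congr rfl fun S _ => ?_
        by_cases hc : S.card ≤ k
        · simp only [hc, and_true, if_true]
          rw [← Finset.sum_filter, Finset.filter_mem_eq_inter, Finset.univ_inter]
        · simp [hc]
      have hcard := card_filter_subset_card_le J hM hJM k
      have e₃ : (∑ S : Finset (Fin d) with S ⊆ J ∧ S.card ≤ k, 2 * (2 ^ k * τ) ^ 2)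
          ≤ 6 * M ^ k * (2 ^ k * τ) ^ 2 := by
        rw [Finset.sum_const, nsmul_eq_mul]
        nlinarith [mul_le_mul_of_nonneg_right hcard (sq_nonneg (2 ^ k * τ))]
      have hterm : (∑ S with S.Nonempty ∧ S.card ≤ k, X.component S f x ^ 2)
          ≤ (∑ S with S.card ≤ k, ∑ i ∈ S, if i ∈ J then 0 else X.component S f x ^ 2)
            + ((∑ S : Finset (Fin d) with S ⊆ J ∧ S.card ≤ k, 2 * (2 ^ k * τ) ^ 2)
            + ∑ S : Finset (Fin d), 2 * (X.component S f - X.efron ∅ S f) x ^ 2) := by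
        rw [Finset.sum_filter, Finset.sum_filter, Finset.sum_filter, ← Finset.sum_add_distrib,
          ← Finset.sum_add_distrib]
        refine Finset.sum_le_sum fun S _ => ?_
        have p1 : 0 ≤ 2 * (2 ^ k * τ) ^ 2 := by positivity
        have p2 : 0 ≤ 2 * (X.component S f - X.efron ∅ S f) x ^ 2 := by positivity
        have p3 : ∀ i ∈ S, 0 ≤ if i ∈ J then 0 else X.component S f x ^ 2 := fun i _ => by
          split_ifs
          exacts [le_rfl, sq_nonneg _]
        have p4 := Finset.sum_nonneg p3
        by_cases hS : S.Nonempty ∧ S.card ≤ k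
        · rw [if_pos hS, if_pos hS.2]
          by_cases hSJ : S ⊆ J
          · rw [if_pos ⟨hSJ, hS.2⟩]
            have := hsmall S hS.1 hS.2
            rw [Pi.sub_apply] at p2 ⊢
            nlinarith [sq_nonneg (X.component S f x - 2 * X.efron ∅ S f x)]
          · obtain ⟨i, hi, hiJ⟩ := Finset.not_subset.1 hSJ
            have := Finset.single_le_sum p3 hi
            rw [if_neg hiJ] at this
            rw [if_neg fun h => hSJ h.1]
            linarith
        · rw [if_neg hS]
          split_ifs <;> linarith
      rw [e₁]
      simp only [ht₃]
      linarith
  have hE := X.expect_mono hpt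
  rw [expect_sum, expect_add, expect_add] at hE
  have hE₁ := sum_expect_not_notable_le hf hC k hη
  have hE₂ : X.expect t₂ ≤ R := by
    refine le_of_sq_le_sq (le_trans (le_of_eq ?_)
      ((expect_indicator_low_weight_sq_le hf k exc).trans ?_)) hR
    · congr!
    refine le_trans (mul_le_mul_of_nonneg_right ?_ (by positivity)) hprob
    exact prob_or_card_notable_le k hθ (by linarith) bad
  have hE₃ : X.expect t₃ ≤ 6 * M ^ k * (2 ^ k * τ) ^ 2 + 2 * (2 ^ d * β ^ 2) := by
    rw [ht₃, expect_add, expect_const, expect_sum]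
    refine add_le_add_right ?_ _
    have := sum_filter_two_mul_sq_le (d := d) β fun _ => True
    rw [Finset.filter_true] at this
    refine (Finset.sum_le_sum fun S _ => ?_).trans this
    rw [expect_const_mul]
    exact mul_le_mul_of_nonneg_left (X.expect_sq_le_of_norm2_le (hB S)) zero_le_two
  linarith

end

/-! ### Choice of parameters and conclusion. -/

theorem IsGammaProduct.mono {X : PartiteComplex Ω} {γ γ' : ℝ} (hX : X.IsGammaProduct γ)
    (h : γ ≤ γ') : X.IsGammaProduct γ' := fun S z hz i j hi hj hij g =>
  (hX S z hz i j hi hj hij g).trans (mul_le_mul_of_nonneg_right h (norm2_nonneg _ _))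

theorem prob_mono (X : PartiteComplex Ω) {p q : (∀ i, Ω i) → Prop} (h : ∀ x, p x → q x) :
    X.prob p ≤ X.prob q := by
  classical
  rw [prob_eq_expect, prob_eq_expect]
  refine X.expect_mono fun x _ => ?_
  by_cases hp : p x
  · simp [hp, h x hp]
  · simp only [hp, if_false]
    split_ifs <;> norm_num

theorem totalInfluence_nonneg (X : PartiteComplex Ω) (f : (∀ i, Ω i) → ℝ) :
    0 ≤ X.totalInfluence f := by
  rw [totalInfluence_eq]
  refine Finset.sum_nonneg fun i _ => ?_
  rw [← expect_lap_sq]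
  exact X.expect_nonneg fun _ _ => sq_nonneg _

/-- A crude Poincaré inequality. -/
theorem variance_sub_le_two_mul_totalInfluence_add {X : PartiteComplex Ω} {f : (∀ i, Ω i) → ℝ}
    {β : ℝ} (hf : ∀ x, X.IsFace x → f x = 1 ∨ f x = -1) (hβ0 : 0 ≤ β) (hβ1 : β ≤ 1)
    (hB : ∀ S, X.norm2 (X.component S f - X.efron ∅ S f) ≤ β)
    (hC : ∀ S, ∀ i ∈ S, X.norm2 (X.component S f - X.component S (X.lap i f)) ≤ β) :
    X.variance f - 3 * β ≤ 2 * X.totalInfluence f + 2 * (d * (2 ^ d * β ^ 2)) := by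
  refine (variance_sub_le_sum_expect_component_sq hf hβ0 hβ1 (hB ∅)).trans
    (le_trans ?_ (sum_card_mul_expect_component_sq_le hC))
  have h0 : ∀ S, 0 ≤ X.expect fun x => X.component S f x ^ 2 := fun S =>
    X.expect_nonneg fun _ _ => sq_nonneg _
  refine (Finset.sum_le_sum fun S hS => ?_).trans (Finset.sum_le_sum_of_subset_of_nonneg
    (Finset.filter_subset _ _) fun S _ _ => mul_nonneg (Nat.cast_nonneg _) (h0 S))
  refine le_mul_of_one_le_left (h0 S) ?_
  exact_mod_cast (Finset.mem_filter.1 hS).2.card_pos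

/-- With `a = 2^d`, both `d` and `d + 1` are at most `a`, so `β ≤ a^3 γ = a^(-17)` and the
accumulated squared error is at most `a^(-32)`. For `d = 0` the error vanishes. -/
theorem commutation_error_bounds (d : ℕ) {γ β : ℝ} (hγ : γ = ((2 : ℝ) ^ (20 * d))⁻¹)
    (hβ : β = (d + 1) * (2 ^ d * (d * γ))) :
    0 ≤ β ∧ β ≤ 1 / 10 ^ 5 ∧ d * (2 ^ d * β ^ 2) ≤ 1 / 10 ^ 8 ∧ 2 ^ d * β ^ 2 ≤ 1 / 10 ^ 8 := by
  rcases Nat.eq_zero_or_pos d with rfl | hd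
  · simp [hβ]
  have hγ0 : 0 ≤ γ := by rw [hγ]; positivity
  have hβ0 : 0 ≤ β := by rw [hβ]; positivity
  set a : ℝ := 2 ^ d with ha
  have ha2 : 2 ≤ a := by
    rw [ha]; exact le_self_pow₀ one_le_two (by omega)
  have ha0 : 0 < a := by linarith
  have hda : (d : ℝ) + 1 ≤ a := by
    rw [ha]; exact_mod_cast Nat.lt_two_pow_self
  have hd1 : (1 : ℝ) ≤ d := by exact_mod_cast hd
  have hγa : γ = (a ^ 20)⁻¹ := by rw [hγ, ha, ← pow_mul, mul_comm]
  have h1 : β ≤ (a ^ 17)⁻¹ :=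
    calc β ≤ a * (a * (a * γ)) := by
          rw [hβ]
          gcongr
          linarith
      _ = (a ^ 17)⁻¹ := by rw [hγa]; field_simp
  have hpow : ∀ n : ℕ, (a ^ n)⁻¹ ≤ (2 ^ n)⁻¹ := fun n => by gcongr
  have h2 : d * (a * β ^ 2) ≤ 1 / 10 ^ 8 :=
    calc d * (a * β ^ 2) ≤ a * (a * ((a ^ 17)⁻¹) ^ 2) := by
          gcongr
          linarith
      _ = (a ^ 32)⁻¹ := by field_simp
      _ ≤ (2 ^ 32)⁻¹ := hpow 32
      _ ≤ _ := by norm_num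
  refine ⟨hβ0, h1.trans ((hpow 17).trans (by norm_num)), h2, le_trans ?_ h2⟩
  exact le_mul_of_one_le_left (by positivity) hd1

/-- If boosters were rarer than `τ`, the main terms of the variance bound would be about `.002` from
high degrees, `.004` from non-notable coordinates and `.001` from exceptional points. All other
terms are tiny, so the total stays below `.01`. -/
theorem le_prob_booster {X : PartiteComplex Ω} {f : (∀ i, Ω i) → ℝ} {β : ℝ}
    (hf : ∀ x, X.IsFace x → f x = 1 ∨ f x = -1) (hβ0 : 0 ≤ β) (hβ1 : β ≤ 1 / 10 ^ 5)
    (hε₁ : d * (2 ^ d * β ^ 2) ≤ 1 / 10 ^ 8) (hε₂ : 2 ^ d * β ^ 2 ≤ 1 / 10 ^ 8)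
    (hB : ∀ S, X.norm2 (X.component S f - X.efron ∅ S f) ≤ β)
    (hC : ∀ S, ∀ i ∈ S, X.norm2 (X.component S f - X.component S (X.lap i f)) ≤ β)
    (hvar : 1 / 100 ≤ X.variance f) {k : ℕ} (hk : 0 < k)
    (hkI : 1000 * X.totalInfluence f ≤ k) {τ : ℝ} (hτ : τ = ((2 : ℝ) ^ (40 * k ^ 2))⁻¹) :
    τ ≤ X.prob fun x => ∃ T : Finset (Fin d), T.card ≤ k ∧ X.IsBooster f τ T x := by
  by_contra! hlt
  set I := X.totalInfluence f with hI
  have hI0 : 0 ≤ I := X.totalInfluence_nonneg f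
  set a : ℝ := 2 ^ k with ha
  set b : ℝ := a ^ k with hb
  have ha2 : 2 ≤ a := by
    rw [ha]; exact le_self_pow₀ one_le_two (by omega)
  have ha0 : 0 < a := by linarith
  have hab : a ≤ b := le_self_pow₀ (by linarith) (by omega)
  have hb0 : 0 < b := by linarith
  have hka : (k : ℝ) ≤ a := by
    rw [ha]; exact_mod_cast Nat.lt_two_pow_self.le
  have hk1 : (1 : ℝ) ≤ k := by exact_mod_cast hk
  have hτb : τ = (b ^ 40)⁻¹ := by
    rw [hτ, hb, ha, ← pow_mul, ← pow_mul]
    congr 2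
    ring
  have hτ0 : 0 ≤ τ := by rw [hτb]; positivity
  have hpow : ∀ m n : ℕ, (m : ℝ) = 2 ^ n → (m : ℝ) ^ k = a ^ n := fun m n h => by
    rw [h, ha, ← pow_mul, ← pow_mul, mul_comm]
  have h16 : (16 : ℝ) ^ k = a ^ 4 := hpow 16 4 (by norm_num)
  have h256 : (256 : ℝ) ^ k = a ^ 8 := hpow 256 8 (by norm_num)
  have h9 : (9 : ℝ) ^ k ≤ a ^ 4 := by
    rw [← h16]; gcongr; norm_num
  have hinv : ∀ n : ℕ, (a ^ n)⁻¹ ≤ (2 ^ n)⁻¹ := fun n => by gcongr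
  -- The power `5` makes `η` cancel both `16^k = a^4` and the influence, which is at most `a /
  -- 1000`.
  set η : ℝ := (a ^ 5)⁻¹ with hη
  have hη0 : 0 < η := by rw [hη]; positivity
  have hIa : I ≤ a / 1000 := by linarith
  -- Here `M = a^50`: large enough that the Markov bound on the number of notable coordinates
  -- survives the later factor `256^k = a^8`.
  have hθ : I / (η ^ 3 / 9 ^ k) / a ^ 50 ≤ (a ^ 30)⁻¹ / 1000 :=
    calc I / (η ^ 3 / 9 ^ k) / a ^ 50 = I * 9 ^ k * a ^ 15 / a ^ 50 := by
          rw [hη]; field_simp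
      _ ≤ (a / 1000) * a ^ 4 * a ^ 15 / a ^ 50 := by gcongr
      _ = _ := by field_simp
  have hprob : (X.prob (fun x => ∃ T : Finset (Fin d), T.card ≤ k ∧ X.IsBooster f τ T x)
      + I / (η ^ 3 / 9 ^ k) / a ^ 50) * 256 ^ k ≤ (1 / 1000 : ℝ) ^ 2 :=
    calc _ ≤ ((a ^ 40)⁻¹ + (a ^ 30)⁻¹ / 1000) * a ^ 8 := by
          rw [h256]
          gcongr
          refine hlt.le.trans ?_
          rw [hτb]
          gcongr
      _ = (a ^ 32)⁻¹ + (a ^ 22)⁻¹ / 1000 := by field_simp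
      _ ≤ (2 ^ 32)⁻¹ + (2 ^ 22)⁻¹ / 1000 := by
          have := hinv 32
          have := hinv 22
          gcongr
      _ ≤ _ := by norm_num
  have main := variance_le_of_prob_booster_le hf hβ0 (hβ1.trans (by norm_num)) hB hC hk hη0 hτ0
    (one_le_pow₀ (by linarith)) (by norm_num) hprob
  have h1 : (2 * I + 2 * (d * (2 ^ d * β ^ 2))) / k ≤ 2 / 1000 + 2 / 10 ^ 8 := by
    rw [div_le_iff₀ (by linarith)]
    nlinarith
  have h2 : 4 * 16 ^ k * η * I ≤ 4 / 1000 :=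
    calc 4 * 16 ^ k * η * I ≤ 4 * a ^ 4 * (a ^ 5)⁻¹ * (a / 1000) := by
          rw [h16, hη]; gcongr
      _ = _ := by field_simp
  -- There are up to `3 M^k` sets of notable coordinates, and `M^k = b^50 = 2^(50 k^2)`. This forces
  -- `τ` to be exponentially small in `k^2` and is the source of `K^2` in the theorem.
  have h3 : 6 * (a ^ 50) ^ k * (a * τ) ^ 2 ≤ 6 / 2 ^ 28 :=
    calc 6 * (a ^ 50) ^ k * (a * τ) ^ 2 ≤ 6 * b ^ 50 * (b * (b ^ 40)⁻¹) ^ 2 := by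
          rw [hτb, hb, ← pow_mul a 50 k, mul_comm 50 k, pow_mul, ← hb]
          gcongr
      _ = 6 / b ^ 28 := by field_simp
      _ ≤ 6 / 2 ^ 28 := by
          gcongr
          linarith
  rw [← hI, ← ha] at main
  norm_num at h1 h2 h3 hβ1 hε₁ hε₂ main
  linarith

end PartiteComplex

end

theorem mainTheorem5 :
    ∃ c C₁ C₂ : ℝ, 0 < c ∧ 0 < C₁ ∧ 0 < C₂ ∧
      ∀ (d : ℕ) (Ω : Fin d → Type u) [∀ i, Fintype (Ω i)] (X : PartiteComplex Ω)
        (γ K : ℝ) (f : (∀ i, Ω i) → ℝ),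
        γ ≤ (2 : ℝ) ^ (-(c * (d : ℝ))) →
        X.IsGammaProduct γ →
        (∀ x, X.IsFace x → f x = 1 ∨ f x = -1) →
        X.totalInfluence f ≤ K →
        (1 / 100 : ℝ) ≤ X.variance f →
        ∃ τ : ℝ, (2 : ℝ) ^ (-(C₁ * K ^ 2)) ≤ τ ∧
          τ ≤ X.prob fun x =>
            ∃ T : Finset (Fin d), (T.card : ℝ) ≤ C₂ * K ∧ X.IsBooster f τ T x := by
  refine ⟨20, 40 * 1250 ^ 2, 1250, by norm_num, by norm_num, by norm_num, ?_⟩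
  intro d Ω _ X γ K f hγ hX hf hK hvar
  -- Passing to the extreme admissible value also guarantees nonnegativity, which `γ` itself may
  -- lack.
  set γ' : ℝ := ((2 : ℝ) ^ (20 * d))⁻¹ with hγ'
  have hγγ' : γ ≤ γ' := by
    refine hγ.trans_eq ?_
    rw [Real.rpow_neg zero_le_two, hγ', ← Real.rpow_natCast]
    push_cast
    rfl
  have hX' := hX.mono hγγ'
  have hγ0 : 0 ≤ γ' := by positivity
  set β : ℝ := (d + 1) * (2 ^ d * (d * γ')) with hβ
  obtain ⟨hβ0, hβ1, hε₁, hε₂⟩ := PartiteComplex.commutation_error_bounds d hγ' hβ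
  have hn := X.norm2_eq_one_of_sign hf
  have hB : ∀ S, X.norm2 (X.component S f - X.efron ∅ S f) ≤ β := fun S => by
    refine (hX'.norm2_component_sub_efron_le hγ0 S f).trans ?_
    rw [hn, mul_one, hβ]
    gcongr
    linarith
  have hC : ∀ S, ∀ i ∈ S, X.norm2 (X.component S f - X.component S (X.lap i f)) ≤ β :=
    fun S i hi => by
      refine (hX'.norm2_component_sub_component_lap_le hγ0 hi f).trans ?_
      rw [hn, mul_one]
  -- The variance keeps `K` away from zero, so rounding up is harmless: `1000 * K + 1 ≤ 1250 * K`.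
  have hI : 4 / 1000 ≤ X.totalInfluence f := by
    have h := PartiteComplex.variance_sub_le_two_mul_totalInfluence_add hf hβ0
      (hβ1.trans (by norm_num)) hB hC
    norm_num at hβ1 hε₁ hvar
    linarith
  set k := ⌈1000 * K⌉₊ with hk
  have hk1 : 1000 * K ≤ k := Nat.le_ceil _
  have hk2 : (k : ℝ) ≤ 1250 * K := by
    have := Nat.ceil_lt_add_one (show 0 ≤ 1000 * K by linarith)
    rw [← hk] at this
    linarith
  have hk0 : 0 < k := Nat.ceil_pos.2 (by linarith)
  refine ⟨((2 : ℝ) ^ (40 * k ^ 2))⁻¹, ?_, ?_⟩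
  · rw [Real.rpow_neg zero_le_two]
    refine inv_anti₀ (by positivity) ?_
    rw [← Real.rpow_natCast]
    refine Real.rpow_le_rpow_of_exponent_le one_le_two ?_
    push_cast
    have := pow_le_pow_left₀ (Nat.cast_nonneg k) hk2 2
    linarith [mul_pow 1250 K 2]
  · refine (PartiteComplex.le_prob_booster hf hβ0 hβ1 hε₁ hε₂ hB hC hvar hk0 (by linarith)
      rfl).trans (X.prob_mono fun x => ?_)
    rintro ⟨T, hT, hboost⟩
    exact ⟨T, le_trans (by exact_mod_cast hT) hk2, hboost⟩
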